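/- Let $d\ge 2$ and let $\mathbb H^d$ be $d$-dimensional hyperbolic space, $\widehat{\mathbb H}^d$ its compactification by the set $\partial\mathbb H^d$ of points at infinity (in the Poincaré ball model: the closed unit ball and the unit sphere). For $C\subseteq\mathbb H^d$ let $\partial C$ be the closure of $C$ in $\widehat{\mathbb H}^d$ minus $\mathbb H^d$. An end of $C$ is a function $e$ assigning to each compact $K\subseteq\mathbb H^d$ a connected component $e(K)$ of $C\setminus K$, such that $e(K)\supseteq e(K')$ whenever $K\subseteq K'$; its boundary is $\partial e=\bigcap_{K}\partial e(K)$, the intersection over all compact $K\subseteq\mathbb H^d$. Let $G$ be a connected simple graph embedded in $\mathbb H^d$ such that its edges are geodesic segments, every compact subset of $\mathbb H^d$ meets only finitely many vertices and edges of $G$, and some group of isometries of $\mathbb H^d$ acts on $G$ by graph automorphisms, transitively on the vertices. Fix a vertex $o$ of $G$. In $p$-Bernoulli bond percolation on $G$ (each edge is open independently with probability $p$; law $\Pr_p$), the clusters are the connected components of the random subgraph formed by all vertices and the open edges, regarded as subsets of $\mathbb H^d$ (edges included), and $C(o)$ is the cluster of $o$. Put $$p_0=\sup\{p\in[0,1]:\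 \Pr_p(x\in\partial C(o))=0\ \text{ for all } x\in\partial\mathbb H^d\}.$$ Then for every $p$ with $0\le p<p_0$, $\Pr_p$-almost surely every cluster $C$ has only one-point boundaries of ends: for every end $e$ of $C$, the set $\partial e$ consists of exactly one point of $\partial\mathbb H^d$. -/

import Mathlib

open MeasureTheory

noncomputable section

/-! ### Hyperbolic space -/

/-- The Poincaré ball model of `d`-dimensional hyperbolic space: the open unit ball of `ℝ^d`, with
its usual topology. The hyperbolic metric is `HypSpace.hdist`. The compactification by the points
at infinity is the closed unit ball, the points at infinity being the unit sphere. -/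
abbrev HypSpace (d : ℕ) : Type := ↥(Metric.ball (0 : EuclideanSpace ℝ (Fin d)) 1)

/-- The points at infinity of hyperbolic space. -/
abbrev HypInfinity (d : ℕ) : Type := ↥(Metric.sphere (0 : EuclideanSpace ℝ (Fin d)) 1)

namespace HypSpace

variable {d : ℕ}

/-- The hyperbolic metric of the Poincaré ball model (curvature `-1`). -/
def hdist (x y : HypSpace d) : ℝ :=
  Real.arcosh (1 + 2 * ‖(x : EuclideanSpace ℝ (Fin d)) - y‖ ^ 2 /
    ((1 - ‖(x : EuclideanSpace ℝ (Fin d))‖ ^ 2) * (1 - ‖(y : EuclideanSpace ℝ (Fin d))‖ ^ 2)))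

/-- The geodesic segment with endpoints `x` and `y`: the points at which the triangle inequality
is an equality. -/
def segment (x y : HypSpace d) : Set (HypSpace d) :=
  {z | hdist x z + hdist z y = hdist x y}

/-- A bijection of hyperbolic space that is an isometry of the hyperbolic metric. -/
def IsIsom (φ : Equiv.Perm (HypSpace d)) : Prop :=
  ∀ x y, hdist (φ x) (φ y) = hdist x y

/-- The boundary `∂C` of a set `C` in hyperbolic space: its closure in the compactification (the
closed ball, which is closed in `ℝ^d`), without the points of hyperbolic space. -/
def boundary (C : Set (HypSpace d)) : Set (EuclideanSpace ℝ (Fin d)) :=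
  closure ((fun x : HypSpace d => (x : EuclideanSpace ℝ (Fin d))) '' C) \
    Metric.ball (0 : EuclideanSpace ℝ (Fin d)) 1

end HypSpace

/-! ### Ends of subsets of a space -/

/-- An end of a subset `C` of a space `X`: a function assigning to every compact subset `K` of `X`
a connected component of `C \ K`, decreasing in `K`. -/
structure SetEnd {X : Type*} [TopologicalSpace X] (C : Set X) where
  /-- The component of `C \ K` chosen by the end. -/
  toFun : TopologicalSpace.Compacts X → Set X
  isComponent : ∀ K : TopologicalSpace.Compacts X, ∃ x ∈ C \ (K : Set X),
    toFun K = connectedComponentIn (C \ (K : Set X)) x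
  antitone : ∀ K K' : TopologicalSpace.Compacts X,
    (K : Set X) ⊆ (K' : Set X) → toFun K' ⊆ toFun K

/-- The boundary of an end `e`: the intersection of the boundaries of `e(K)`, `K` compact. -/
def SetEnd.boundary {d : ℕ} {C : Set (HypSpace d)} (e : SetEnd C) :
    Set (EuclideanSpace ℝ (Fin d)) :=
  ⋂ K : TopologicalSpace.Compacts (HypSpace d), HypSpace.boundary (e.toFun K)

/-! ### Embedded graphs with geodesic edges -/

/-- A simple graph embedded in hyperbolic space whose edges are geodesic segments: the vertices are
points, the edge joining `u` and `v` is the geodesic segment from `u` to `v`, an edge passes through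
no vertex except its endpoints, and two distinct edges meet only in common endpoints. -/
structure HypGraph (d : ℕ) where
  verts : Set (HypSpace d)
  graph : SimpleGraph verts
  vertex_on_edge : ∀ u v w : verts, graph.Adj u v →
    (w : HypSpace d) ∈ HypSpace.segment (u : HypSpace d) v → w = u ∨ w = v
  edge_inter_edge : ∀ u v u' v' : verts, graph.Adj u v → graph.Adj u' v' → s(u, v) ≠ s(u', v') →
    ∀ z ∈ HypSpace.segment (u : HypSpace d) v ∩ HypSpace.segment (u' : HypSpace d) v',
      (z = u ∨ z = v) ∧ (z = u' ∨ z = v')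

namespace HypGraph

variable {d : ℕ} (G : HypGraph d)

/-- The geodesic segment that represents an edge. -/
def edgeSegment (e : Sym2 G.verts) : Set (HypSpace d) :=
  {z | ∃ u v : G.verts, e = s(u, v) ∧ z ∈ HypSpace.segment (u : HypSpace d) v}

/-- Every compact subset of hyperbolic space meets only finitely many vertices and edges. -/
def IsLocallyFinite : Prop :=
  ∀ K : Set (HypSpace d), IsCompact K →
    (G.verts ∩ K).Finite ∧ {e ∈ G.graph.edgeSet | (G.edgeSegment e ∩ K).Nonempty}.Finite

/-- Some group of isometries of hyperbolic space acts on the graph by graph automorphisms,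
transitively on the vertices. -/
def IsTransitiveUnderIsometries : Prop :=
  ∃ Γ : Subgroup (Equiv.Perm (HypSpace d)),
    (∀ φ ∈ Γ, HypSpace.IsIsom φ ∧
      ∃ σ : G.graph ≃g G.graph, ∀ v : G.verts, (σ v : HypSpace d) = φ (v : HypSpace d)) ∧
    ∀ u v : G.verts, ∃ φ ∈ Γ, φ (u : HypSpace d) = v

/-! ### Bernoulli bond percolation -/

/-- The law of `p`-Bernoulli bond percolation: the random set of edges (open edges) that contains
each edge independently with probability `p`. -/
def percolation (p : unitInterval) : Measure (Set G.graph.edgeSet) :=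
  ProbabilityTheory.setBernoulli Set.univ p

/-- The subgraph of open edges, with all the vertices. -/
def openGraph (ω : Set G.graph.edgeSet) : SimpleGraph G.verts :=
  SimpleGraph.fromEdgeSet ((fun e : G.graph.edgeSet => (e : Sym2 G.verts)) '' ω)

/-- The cluster of the vertex `v`, as a subset of hyperbolic space: all the vertices joined to `v`
by an open path, together with the open edges at those vertices. -/
def cluster (ω : Set G.graph.edgeSet) (v : G.verts) : Set (HypSpace d) :=
  {z | ∃ w : G.verts, (G.openGraph ω).Reachable v w ∧
    (z = w ∨ ∃ w' : G.verts, (G.openGraph ω).Adj w w' ∧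
      z ∈ HypSpace.segment (w : HypSpace d) w')}

/-- The set of parameters `p` for which no point at infinity lies with positive probability in the
boundary of the cluster of `o`. -/
def nullParameters (o : G.verts) : Set unitInterval :=
  {p | ∀ ξ : HypInfinity d,
    G.percolation p {ω | (ξ : EuclideanSpace ℝ (Fin d)) ∈ HypSpace.boundary (G.cluster ω o)} = 0}

/-- The threshold `p₀`. -/
def pZero (o : G.verts) : ℝ :=
  sSup ((fun p : unitInterval => (p : ℝ)) '' G.nullParameters o)

end HypGraph

end

/-! Take a parameter `q > p` at which no point at infinity is hit with positive probability. By
compactness, at `q` the cluster of `o` rarely meets a small `target`, uniformly in its direction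
(`exists_target_small`). A target is defined through hyperbolic distances only, so transitivity
gives the same bound at each vertex. Now look at the slab of heights at most `h` next to the sphere:
a slab vertex at Euclidean distance at least `n * h` from a slab vertex `v` is, seen from `v`, far
away and close to the direction of the origin (`mem_target_origin`). Hence at `q`, reaching distance
`n * h` inside the slab is unlikely, uniformly in `v` and `h`.

The slab is not transitive, but this uniform bound is all that the Duminil-Copin–Tassion argument
needs. Russo's formula on `[p, q]` yields around each `v` a finite set with at most `1/2` expected
exits at `p` (`exists_cutSum_le_half`). Iterating over such sets (`bernProb_conn_le_cutSum`) bounds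
the probability of reaching distance `k * (B * h)` in the slab by `(1/2) ^ k` (`exists_slab_decay`).

Only polynomially many vertices in `1 / h` have height comparable to `h`, so by a union bound the
probability that one of them is joined to Euclidean distance `δ` inside the slab tends to `0` along
a sequence of heights tending to `0` (`ae_not_eventually_crossing`). An end with two boundary points
would force such crossings at all small heights (`mem_crossing_of_end`). That an end has some
boundary point is compactness of the closed ball. -/

noncomputable section

/-! ### Finite Bernoulli percolation -/

section Bernoulli

open scoped Classical

variable {α : Type*}

/-- The expectation of `f` at a random subset of the finite set `E` that contains each element
independently with probability `p`. -/
def bern (p : ℝ) (E : Finset α) (f : Finset α → ℝ) : ℝ :=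
  ∑ ω ∈ E.powerset, p ^ ω.card * (1 - p) ^ (E.card - ω.card) * f ω

/-- The probability of an event for a random subset of the finite set `E`. -/
def bernProb (p : ℝ) (E : Finset α) (A : Finset α → Prop) : ℝ :=
  bern p E (fun ω => if A ω then 1 else 0)

lemma bern_empty (p : ℝ) (f : Finset α → ℝ) : bern p ∅ f = f ∅ := by
  simp [bern]

lemma bern_insert [DecidableEq α] (p : ℝ) {E : Finset α} {e : α} (he : e ∉ E) (f : Finset α → ℝ) :
    bern p (insert e E) f = (1 - p) * bern p E f + p * bern p E (fun ω => f (insert e ω)) := by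
  unfold bern
  rw [Finset.sum_powerset_insert he, Finset.mul_sum, Finset.mul_sum]
  congr 1
  · refine Finset.sum_congr rfl fun ω hω => ?_
    have h1 : e ∉ ω := fun h => he (Finset.mem_powerset.1 hω h)
    have h2 := Finset.card_le_card (Finset.mem_powerset.1 hω)
    rw [Finset.card_insert_of_notMem he, Nat.succ_sub h2, pow_succ]
    ring
  · refine Finset.sum_congr rfl fun ω hω => ?_
    have h1 : e ∉ ω := fun h => he (Finset.mem_powerset.1 hω h)
    rw [Finset.card_insert_of_notMem h1, Finset.card_insert_of_notMem he, Nat.add_sub_add_right]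
    ring

lemma bern_const (p : ℝ) (E : Finset α) (c : ℝ) : bern p E (fun _ => c) = c := by
  induction E using Finset.induction_on with
  | empty => simp [bern_empty]
  | insert e E he ih => rw [bern_insert p he, ih]; ring

lemma bern_mono {p : ℝ} (hp : 0 ≤ p) (hp1 : p ≤ 1) {E : Finset α} {f g : Finset α → ℝ}
    (h : ∀ ω ⊆ E, f ω ≤ g ω) : bern p E f ≤ bern p E g := by
  refine Finset.sum_le_sum fun ω hω => ?_
  have : 0 ≤ 1 - p := by linarith
  exact mul_le_mul_of_nonneg_left (h ω (Finset.mem_powerset.1 hω)) (by positivity)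

lemma bern_congr {p : ℝ} {E : Finset α} {f g : Finset α → ℝ}
    (h : ∀ ω ⊆ E, f ω = g ω) : bern p E f = bern p E g :=
  Finset.sum_congr rfl fun ω hω => by rw [h ω (Finset.mem_powerset.1 hω)]

lemma bern_sum {ι : Type*} (p : ℝ) (E : Finset α) (s : Finset ι) (f : ι → Finset α → ℝ) :
    bern p E (fun ω => ∑ i ∈ s, f i ω) = ∑ i ∈ s, bern p E (f i) := by
  unfold bern
  rw [Finset.sum_comm]
  exact Finset.sum_congr rfl fun ω _ => Finset.mul_sum _ _ _

lemma bern_sub (p : ℝ) (E : Finset α) (f g : Finset α → ℝ) :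
    bern p E (fun ω => f ω - g ω) = bern p E f - bern p E g := by
  unfold bern
  rw [← Finset.sum_sub_distrib]
  exact Finset.sum_congr rfl fun ω _ => by ring

lemma bern_nonneg {p : ℝ} (hp : 0 ≤ p) (hp1 : p ≤ 1) {E : Finset α} {f : Finset α → ℝ}
    (h : ∀ ω ⊆ E, 0 ≤ f ω) : 0 ≤ bern p E f := by
  simpa [bern_const] using bern_mono hp hp1 (f := fun _ => 0) h

lemma bernProb_nonneg {p : ℝ} (hp : 0 ≤ p) (hp1 : p ≤ 1) (E : Finset α) (A : Finset α → Prop) :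
    0 ≤ bernProb p E A :=
  bern_nonneg hp hp1 fun ω _ => by split_ifs <;> norm_num

lemma bernProb_le_one {p : ℝ} (hp : 0 ≤ p) (hp1 : p ≤ 1) (E : Finset α) (A : Finset α → Prop) :
    bernProb p E A ≤ 1 := by
  rw [← bern_const p E 1]
  exact bern_mono hp hp1 fun ω _ => by split_ifs <;> norm_num

lemma bernProb_mono {p : ℝ} (hp : 0 ≤ p) (hp1 : p ≤ 1) {E : Finset α} {A B : Finset α → Prop}
    (h : ∀ ω ⊆ E, A ω → B ω) : bernProb p E A ≤ bernProb p E B :=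
  bern_mono hp hp1 fun ω hω => by
    by_cases hA : A ω
    · simp [hA, h ω hω hA]
    · simp only [hA, if_false]; split_ifs <;> norm_num

/-- The expectation of an increasing function is increasing in the parameter. -/
lemma bern_mono_param {p q : ℝ} (hp : 0 ≤ p) (hpq : p ≤ q) (hq : q ≤ 1) (E : Finset α)
    {f : Finset α → ℝ} (hf : ∀ ω ω', ω ⊆ ω' → f ω ≤ f ω') : bern p E f ≤ bern q E f := by
  induction E using Finset.induction_on generalizing f with
  | empty => simp [bern_empty]
  | insert e E he ih =>
    rw [bern_insert p he, bern_insert q he]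
    have h1 := ih hf
    have h2 := ih (f := fun ω => f (insert e ω))
      fun ω ω' h => hf _ _ (Finset.insert_subset_insert e h)
    have h3 : bern q E f ≤ bern q E (fun ω => f (insert e ω)) :=
      bern_mono (hp.trans hpq) hq fun ω _ => hf _ _ (Finset.subset_insert e ω)
    nlinarith

lemma bernProb_mono_param {p q : ℝ} (hp : 0 ≤ p) (hpq : p ≤ q) (hq : q ≤ 1) (E : Finset α)
    {A : Finset α → Prop} (hA : ∀ ω ω', ω ⊆ ω' → A ω → A ω') :
    bernProb p E A ≤ bernProb q E A :=
  bern_mono_param hp hpq hq E fun ω ω' h => by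
    by_cases h1 : A ω
    · simp [h1, hA ω ω' h h1]
    · simp only [h1, if_false]; split_ifs <;> norm_num

/-- Independence: the expectation of a product factorizes if one factor depends only on the
elements in `T` and the other one only on those outside `T`. -/
lemma bern_mul [DecidableEq α] {p : ℝ} (T : Set α) (E : Finset α) {f g : Finset α → ℝ}
    (hf : ∀ e ∉ T, ∀ ω, f (insert e ω) = f ω) (hg : ∀ e ∈ T, ∀ ω, g (insert e ω) = g ω) :
    bern p E (fun ω => f ω * g ω) = bern p E f * bern p E g := by
  induction E using Finset.induction_on generalizing f g with
  | empty => simp [bern_empty]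
  | insert e E he ih =>
    rw [bern_insert p he, bern_insert p he, bern_insert p he, ih hf hg]
    by_cases hT : e ∈ T
    · have h := ih (f := fun ω => f (insert e ω)) (g := g)
        (fun e' h' ω => by rw [Finset.insert_comm, hf e' h']) hg
      simp only [hg e hT] at h ⊢
      rw [h]; ring
    · have h := ih (f := f) (g := fun ω => g (insert e ω)) hf
        (fun e' h' ω => by rw [Finset.insert_comm, hg e' h'])
      simp only [hf e hT] at h ⊢
      rw [h]; ring

lemma bernProb_and [DecidableEq α] {p : ℝ} (T : Set α) (E : Finset α) {A B : Finset α → Prop}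
    (hA : ∀ e ∉ T, ∀ ω, A (insert e ω) ↔ A ω) (hB : ∀ e ∈ T, ∀ ω, B (insert e ω) ↔ B ω) :
    bernProb p E (fun ω => A ω ∧ B ω) = bernProb p E A * bernProb p E B := by
  unfold bernProb
  rw [← bern_mul T E (fun e he ω => by simp only [hA e he]) (fun e he ω => by simp only [hB e he])]
  refine bern_congr fun ω _ => ?_
  by_cases h1 : A ω <;> by_cases h2 : B ω <;> simp [h1, h2]

/-- Russo's formula. -/
lemma hasDerivAt_bern [DecidableEq α] (E : Finset α) (f : Finset α → ℝ) (p : ℝ) :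
    HasDerivAt (fun q => bern q E f)
      (∑ e ∈ E, bern p E (fun ω => f (insert e ω) - f (ω.erase e))) p := by
  induction E using Finset.induction_on generalizing f with
  | empty => simpa [bern_empty] using hasDerivAt_const p (f ∅)
  | insert e E he ih =>
    have h1 := ih f
    have h2 := ih (fun ω => f (insert e ω))
    have h3 : HasDerivAt (fun q : ℝ => 1 - q) (-1) p := by
      simpa using (hasDerivAt_id p).const_sub 1
    have h4 := (h3.mul h1).add ((hasDerivAt_id p).mul h2)
    have h5 : (fun q => bern q (insert e E) f) = ((fun q : ℝ => 1 - q) * fun q => bern q E f) +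
        (id * fun q => bern q E fun ω => f (insert e ω)) := by
      funext q; simp [bern_insert q he]
    rw [h5]
    refine h4.congr_deriv (Eq.symm ?_)
    rw [Finset.sum_insert he, bern_insert p he]
    -- The discrete derivative in the direction `e` ignores the state of `e`, so it gives the same
    -- value in both halves of `bern_insert`.
    have h6 : bern p E (fun ω => f (insert e ω) - f (ω.erase e)) =
        bern p E (fun ω => f (insert e ω)) - bern p E f := by
      rw [← bern_sub]
      exact bern_congr fun ω hω => by
        rw [Finset.erase_eq_of_notMem fun h => he (hω h)]
    have h7 : bern p E (fun ω => f (insert e (insert e ω)) - f ((insert e ω).erase e)) =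
        bern p E (fun ω => f (insert e ω)) - bern p E f := by
      rw [← bern_sub]
      exact bern_congr fun ω hω => by
        rw [Finset.erase_insert fun h => he (hω h), Finset.insert_idem]
    have h8 : ∑ e' ∈ E, bern p (insert e E) (fun ω => f (insert e' ω) - f (ω.erase e')) =
        (1 - p) * ∑ e' ∈ E, bern p E (fun ω => f (insert e' ω) - f (ω.erase e')) +
        p * ∑ e' ∈ E, bern p E (fun ω => f (insert e (insert e' ω)) - f (insert e (ω.erase e')))
        := by
      rw [Finset.mul_sum, Finset.mul_sum, ← Finset.sum_add_distrib]
      refine Finset.sum_congr rfl fun e' he' => ?_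
      have hne : e ≠ e' := fun h => he (h ▸ he')
      rw [bern_insert p he]
      simp only [Finset.insert_comm e' e, Finset.erase_insert_of_ne hne]
    rw [h6, h7, h8]
    simp only [id]
    ring

end Bernoulli

section Bernoulli

open scoped Classical

variable {α : Type*}

lemma bernProb_eq_bern (p : ℝ) (E : Finset α) (A : Finset α → Prop) :
    bernProb p E A = bern p E (fun ω => if A ω then 1 else 0) := rfl

lemma bernProb_not (p : ℝ) (E : Finset α) (A : Finset α → Prop) :
    bernProb p E (fun ω => ¬ A ω) = 1 - bernProb p E A := by
  rw [bernProb_eq_bern, bernProb_eq_bern, ← bern_const p E 1, ← bern_sub, bern_const]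
  exact bern_congr fun ω _ => by by_cases h : A ω <;> simp [h]

lemma bernProb_le_sum {ι : Type*} {p : ℝ} (hp : 0 ≤ p) (hp1 : p ≤ 1) {E : Finset α}
    (I : Finset ι) {A : Finset α → Prop} {B : ι → Finset α → Prop}
    (h : ∀ ω ⊆ E, A ω → ∃ i ∈ I, B i ω) : bernProb p E A ≤ ∑ i ∈ I, bernProb p E (B i) := by
  unfold bernProb
  rw [← bern_sum]
  refine bern_mono hp hp1 fun ω hω => ?_
  by_cases hA : A ω
  · obtain ⟨i, hi, hB⟩ := h ω hω hA
    rw [if_pos hA]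
    calc (1 : ℝ) = if B i ω then 1 else 0 := by simp [hB]
      _ ≤ _ := Finset.single_le_sum (f := fun i => if B i ω then (1 : ℝ) else 0)
        (fun j _ => by split_ifs <;> norm_num) hi
  · rw [if_neg hA]
    exact Finset.sum_nonneg fun j _ => by split_ifs <;> norm_num

lemma sum_ite_le_ite {ι : Type*} (I : Finset ι) {A : Prop} {B : ι → Prop}
    (h : ∀ i ∈ I, B i → A) (hu : ∀ i ∈ I, ∀ j ∈ I, B i → B j → i = j) :
    (∑ i ∈ I, if B i then (1 : ℝ) else 0) ≤ if A then 1 else 0 := by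
  by_cases hB : ∃ i ∈ I, B i
  · obtain ⟨i, hi, hBi⟩ := hB
    rw [if_pos (h i hi hBi), Finset.sum_eq_single_of_mem i hi, if_pos hBi]
    exact fun j hj hji => if_neg fun hBj => hji (hu j hj i hi hBj hBi)
  · push Not at hB
    rw [Finset.sum_eq_zero fun i hi => if_neg (hB i hi)]
    split_ifs <;> norm_num

lemma sum_bernProb_le {ι : Type*} {p : ℝ} (hp : 0 ≤ p) (hp1 : p ≤ 1) {E : Finset α}
    (I : Finset ι) {A : Finset α → Prop} {B : ι → Finset α → Prop}
    (h : ∀ ω ⊆ E, ∀ i ∈ I, B i ω → A ω)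
    (hu : ∀ ω ⊆ E, ∀ i ∈ I, ∀ j ∈ I, B i ω → B j ω → i = j) :
    ∑ i ∈ I, bernProb p E (B i) ≤ bernProb p E A := by
  unfold bernProb
  rw [← bern_sum]
  exact bern_mono hp hp1 fun ω hω => sum_ite_le_ite I (h ω hω) (hu ω hω)

end Bernoulli

/-! ### Paths with edges in a given set -/

section Paths

variable {V : Type*}

/-- The vertices `x` and `y` are joined by a path with edges in `R`. -/
def Conn (R : Set (Sym2 V)) : V → V → Prop := Relation.ReflTransGen fun a b => s(a, b) ∈ R

/-- The edges with both endpoints in `S`. -/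
def inside (S : Set V) : Set (Sym2 V) := {e | ∀ x ∈ e, x ∈ S}

@[simp] lemma mk_mem_inside {S : Set V} {x y : V} : s(x, y) ∈ inside S ↔ x ∈ S ∧ y ∈ S := by
  simp [inside]

lemma Conn.refl (R : Set (Sym2 V)) (x : V) : Conn R x x := Relation.ReflTransGen.refl

lemma Conn.mono {R R' : Set (Sym2 V)} (h : R ⊆ R') {x y : V} (hc : Conn R x y) : Conn R' x y :=
  Relation.ReflTransGen.mono (fun _ _ hab => h hab) _ _ hc

lemma Conn.symm {R : Set (Sym2 V)} {x y : V} (hc : Conn R x y) : Conn R y x :=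
  have : Std.Symm fun a b : V => s(a, b) ∈ R := ⟨fun a b h => by rwa [Sym2.eq_swap]⟩
  Relation.ReflTransGen.stdSymm.symm _ _ hc

lemma Conn.trans {R : Set (Sym2 V)} {x y z : V} (h : Conn R x y) (h' : Conn R y z) : Conn R x z :=
  Relation.ReflTransGen.trans h h'

lemma Conn.single {R : Set (Sym2 V)} {x y : V} (h : s(x, y) ∈ R) : Conn R x y :=
  Relation.ReflTransGen.single h

lemma Conn.mem_of_inside {S : Set V} {R : Set (Sym2 V)} {x y : V} (hc : Conn (R ∩ inside S) x y)
    (hx : x ∈ S) : y ∈ S := by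
  induction hc with
  | refl => exact hx
  | tail _ h _ => exact (mk_mem_inside.1 h.2).2

/-- `S` is the set of the vertices not joined to the complement of `L`. -/
def IsSeparated (L S : Set V) (R : Set (Sym2 V)) : Prop :=
  ∀ x, x ∈ S ↔ ¬ ∃ y ∉ L, Conn R x y

lemma IsSeparated.subset {L S : Set V} {R : Set (Sym2 V)} (h : IsSeparated L S R) : S ⊆ L :=
  fun x hx => by_contra fun hL => (h x).1 hx ⟨x, hL, Conn.refl R x⟩

/-- No path leading from outside `S` to the complement of `L` can enter `S`, so the edges inside `S`
are never examined. This makes the event independent of the percolation inside `S`. -/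
lemma IsSeparated.of_agree {L S : Set V} {R R' : Set (Sym2 V)} (h : IsSeparated L S R)
    (h1 : ∀ e ∉ inside S, e ∈ R → e ∈ R') (h2 : ∀ e ∉ inside S, e ∈ R' → e ∈ R) :
    IsSeparated L S R' := by
  intro x
  constructor
  · rintro hx ⟨y, hy, hc⟩
    have key : ∀ z, Conn R' z y → z ∉ S := by
      intro z hz
      induction hz using Relation.ReflTransGen.head_induction_on with
      | refl => exact fun hS => hy (h.subset hS)
      | @head a c hac _ ih =>
        intro ha
        have hc' : ∃ y ∉ L, Conn R c y := by
          by_contra hn; exact ih ((h c).2 hn)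
        obtain ⟨y', hy', hcy⟩ := hc'
        exact (h a).1 ha ⟨y', hy', (Conn.single (h2 _ (fun hi => ih (mk_mem_inside.1 hi).2)
          hac)).trans hcy⟩
    exact key x hc hx
  · intro hx
    by_contra hxS
    have hc' : ∃ y ∉ L, Conn R x y := by
      by_contra hn; exact hxS ((h x).2 hn)
    obtain ⟨y, hy, hc⟩ := hc'
    refine hx ⟨y, hy, ?_⟩
    clear hx hxS
    induction hc using Relation.ReflTransGen.head_induction_on with
    | refl => exact Conn.refl _ _
    | @head a c hac hcy ih =>
      have ha : a ∉ S := fun ha => (h a).1 ha ⟨y, hy, Relation.ReflTransGen.head hac hcy⟩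
      exact (Conn.single (h1 _ (fun hi => ha (mk_mem_inside.1 hi).1) hac)).trans ih

/-- `C` is the set of the vertices joined to `v` inside `S`. -/
def IsClusterIn (S : Set V) (v : V) (C : Set V) (R : Set (Sym2 V)) : Prop :=
  ∀ x, x ∈ C ↔ Conn (R ∩ inside S) v x

/-- Exploring the cluster from `v` examines only edges with an endpoint in `C`; all other edges
remain independent of it. -/
lemma IsClusterIn.of_agree {S C : Set V} {v : V} {R R' : Set (Sym2 V)} (h : IsClusterIn S v C R)
    (h1 : ∀ e, (∃ x ∈ e, x ∈ C) → e ∈ R → e ∈ R') (h2 : ∀ e, (∃ x ∈ e, x ∈ C) → e ∈ R' → e ∈ R) :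
    IsClusterIn S v C R' := by
  intro x
  constructor
  · intro hx
    have hc := (h x).1 hx
    clear hx
    induction hc with
    | refl => exact Conn.refl _ _
    | @tail a b hva hab ih =>
      exact Conn.trans ih (Conn.single ⟨h1 _ ⟨a, by simp, (h a).2 hva⟩ hab.1, hab.2⟩)
  · intro hc
    induction hc with
    | refl => exact (h v).2 (Conn.refl _ _)
    | @tail a b hva hab ih =>
      exact (h b).2 (((h a).1 ih).trans (Conn.single ⟨h2 _ ⟨a, by simp, ih⟩ hab.1, hab.2⟩))

/-- A path from a set to its complement leaves the set for the last time. -/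
lemma Conn.exists_last_exit {R : Set (Sym2 V)} {C : Set V} {v t : V} (hc : Conn R v t)
    (hv : v ∈ C) (ht : t ∉ C) :
    ∃ x ∈ C, ∃ y ∉ C, s(x, y) ∈ R ∧ Conn (R ∩ inside Cᶜ) y t := by
  have key : (v ∉ C ∧ Conn (R ∩ inside Cᶜ) v t) ∨
      ∃ x ∈ C, ∃ y ∉ C, s(x, y) ∈ R ∧ Conn (R ∩ inside Cᶜ) y t := by
    clear hv
    induction hc using Relation.ReflTransGen.head_induction_on with
    | refl => exact Or.inl ⟨ht, Conn.refl _ _⟩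
    | @head a c hac _ ih =>
      rcases ih with ⟨h1, h2⟩ | h
      · by_cases ha : a ∈ C
        · exact Or.inr ⟨a, ha, c, h1, hac, h2⟩
        · exact Or.inl ⟨ha, Relation.ReflTransGen.head ⟨hac, mk_mem_inside.2 ⟨ha, h1⟩⟩ h2⟩
      · exact Or.inr h
  rcases key with h | h
  · exact absurd hv h.1
  · exact h

/-- The edge `e` leads out of `S` from a vertex joined to `v` inside `S`. -/
def LeadsOut (S : Set V) (v : V) (e : Sym2 V) (R : Set (Sym2 V)) : Prop :=
  ∃ x ∈ S, ∃ y ∉ S, e = s(x, y) ∧ Conn (R ∩ inside S) v x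

lemma LeadsOut.mono {S : Set V} {v : V} {e : Sym2 V} {R R' : Set (Sym2 V)} (h : R ⊆ R')
    (hl : LeadsOut S v e R) : LeadsOut S v e R' := by
  obtain ⟨x, hx, y, hy, he, hc⟩ := hl
  exact ⟨x, hx, y, hy, he, hc.mono (Set.inter_subset_inter_left _ h)⟩

end Paths

/-! ### Sharpness in a finite graph -/

section Sharpness

open scoped Classical

variable {V : Type*}

/-- The expected number of edges leading out of `S` from a vertex joined to `v` inside `S`. -/
def cutSum (p : ℝ) (E : Finset (Sym2 V)) (S : Set V) (v : V) : ℝ :=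
  ∑ e ∈ E, bernProb p E fun ω => LeadsOut S v e (ω : Set (Sym2 V))

/-- A Simon–Lieb type inequality. Let `C` be the cluster of `v` inside `S`. A path to `T` leaves `C`
for the last time through an edge to some `y ∉ S` and avoids `C` afterwards. Given `C`, this
continuation uses unexplored edges only, so it costs a factor at most `M`. -/
lemma bernProb_conn_le_cutSum {p : ℝ} (hp : 0 ≤ p) (hp1 : p ≤ 1) (E : Finset (Sym2 V))
    (S : Finset V) {v : V} (hv : v ∈ S) (T : Set V) (hT : ∀ t ∈ T, t ∉ S) {M : ℝ}
    (hM : ∀ x ∈ S, ∀ y ∉ S, s(x, y) ∈ E → bernProb p E (fun ω => ∃ t ∈ T, Conn ω y t) ≤ M) :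
    bernProb p E (fun ω => ∃ t ∈ T, Conn ω v t) ≤ cutSum p E S v * M := by
  let Q : Sym2 V → Finset V → Prop := fun e C => ∃ x ∈ C, ∃ y ∉ S, e = s(x, y)
  let X : Sym2 V → Finset V → Finset (Sym2 V) → Prop := fun e C ω =>
    ∃ x ∈ C, ∃ y ∉ S, e = s(x, y) ∧ ∃ t ∈ T, Conn (ω ∩ inside (C : Set V)ᶜ) y t
  have h1 : bernProb p E (fun ω => ∃ t ∈ T, Conn ω v t) ≤
      ∑ i ∈ E ×ˢ S.powerset, bernProb p E
        (fun ω => IsClusterIn S v i.2 ω ∧ X i.1 i.2 ω) := by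
    refine bernProb_le_sum hp hp1 _ ?_
    rintro ω hω ⟨t, ht, hc⟩
    set C : Finset V := S.filter fun x => Conn (ω ∩ inside (S : Set V)) v x with hC
    have hCl : IsClusterIn S v C ω := by
      intro x
      simp only [hC, Finset.coe_filter, Set.mem_ofPred_eq]
      exact ⟨fun h => h.2, fun h => ⟨h.mem_of_inside hv, h⟩⟩
    have hvC : v ∈ (C : Set V) := (hCl v).2 (Conn.refl _ _)
    have htC : t ∉ (C : Set V) := fun h => hT t ht (Finset.mem_filter.1 (Finset.mem_coe.1 h)).1
    obtain ⟨x, hx, y, hy, hxy, hyt⟩ := hc.exists_last_exit hvC htC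
    have hxS : x ∈ S := (Finset.mem_filter.1 (Finset.mem_coe.1 hx)).1
    refine ⟨(s(x, y), C), ?_, hCl, x, hx, y, fun hyS => hy ?_, rfl, t, ht, hyt⟩
    · simp only [Finset.mem_product, Finset.mem_powerset]
      exact ⟨hω hxy, Finset.filter_subset _ _⟩
    · exact (hCl y).2 (((hCl x).1 hx).trans (Conn.single ⟨hxy, mk_mem_inside.2 ⟨hxS, hyS⟩⟩))
  have hM' : ∀ e ∈ E, ∀ C ∈ S.powerset, bernProb p E (fun ω => IsClusterIn S v C ω ∧ X e C ω) ≤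
      bernProb p E (fun ω => IsClusterIn S v C ω ∧ Q e C) * M := by
    intro e he C hC
    have hCS := Finset.mem_powerset.1 hC
    by_cases hQ : Q e C
    · obtain ⟨x, hx, y, hy, hxy⟩ := id hQ
      have hind : bernProb p E (fun ω => IsClusterIn S v C ω ∧ X e C ω) =
          bernProb p E (fun ω => IsClusterIn S v C ω) * bernProb p E (X e C) := by
        refine bernProb_and {e | ∃ x ∈ e, x ∈ (C : Set V)} E ?_ ?_
        · intro e' he' ω
          have hne : ∀ f : Sym2 V, (∃ x ∈ f, x ∈ (C : Set V)) → f ≠ e' :=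
            fun f hf h => he' (h ▸ hf)
          constructor
          · refine fun h => h.of_agree (fun f hf hfω => ?_) (fun f _ hfω => ?_)
            · simpa [hne f hf] using hfω
            · simpa using Or.inr hfω
          · refine fun h => h.of_agree (fun f _ hfω => ?_) (fun f hf hfω => ?_)
            · simpa using Or.inr hfω
            · simpa [hne f hf] using hfω
        · intro e' he' ω
          have : ((insert e' ω : Finset (Sym2 V)) : Set (Sym2 V)) ∩ inside (C : Set V)ᶜ =
              (ω : Set (Sym2 V)) ∩ inside (C : Set V)ᶜ := by
            obtain ⟨z, hz, hzC⟩ := he'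
            rw [Finset.coe_insert, Set.insert_inter_of_notMem]
            exact fun h => h z hz hzC
          simp only [X]
          rw [this]
      rw [hind]
      have hX : bernProb p E (X e C) ≤ M := by
        refine le_trans (bernProb_mono hp hp1 fun ω _ h => ?_) (hM x (hCS hx) y hy (hxy ▸ he))
        obtain ⟨x', hx', y', hy', hxy', t, ht, hc⟩ := h
        -- The witnesses in `X e C` could orient `e` differently, but only one endpoint of `e` lies
        -- in `S`.
        have : y' = y := by
          rw [hxy, Sym2.eq_iff] at hxy'
          rcases hxy' with ⟨_, h⟩ | ⟨_, h⟩
          · exact h.symm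
          · exact absurd (hCS (h ▸ hx')) hy
        subst this
        exact ⟨t, ht, hc.mono Set.inter_subset_left⟩
      refine (mul_le_mul_of_nonneg_left hX (bernProb_nonneg hp hp1 _ _)).trans_eq ?_
      simp only [hQ, and_true]
    · have h0 : ∀ ω, ¬ X e C ω := fun ω ⟨x, hx, y, hy, h, _⟩ => hQ ⟨x, hx, y, hy, h⟩
      simp [h0, hQ, bernProb, bern_const]
  rw [Finset.sum_product] at h1
  refine h1.trans ?_
  unfold cutSum
  rw [Finset.sum_mul]
  refine Finset.sum_le_sum fun e he => (Finset.sum_le_sum (hM' e he)).trans ?_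
  rw [← Finset.sum_mul]
  by_cases hMn : 0 ≤ M
  · refine mul_le_mul_of_nonneg_right ?_ hMn
    refine sum_bernProb_le hp hp1 _ ?_ ?_
    · rintro ω _ C hC ⟨hCl, x, hx, y, hy, hxy⟩
      exact ⟨x, Finset.mem_powerset.1 hC hx, y, hy, hxy, (hCl x).1 hx⟩
    · rintro ω _ C _ C' _ ⟨h, _⟩ ⟨h', _⟩
      ext x
      have := (h x).trans (h' x).symm
      simpa using this
  -- A negative `M` contradicts `hM` as soon as one edge of `E` leaves `S`; so no edge does, and
  -- both sides vanish.
  · have h0 : ∀ ω : Finset (Sym2 V), ¬ LeadsOut (S : Set V) v e ω := by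
      rintro ω ⟨x, hx, y, hy, hxy, _⟩
      exact hMn ((bernProb_nonneg hp hp1 _ _).trans (hM x hx y hy (hxy ▸ he)))
    have h1 : ∀ C ∈ S.powerset, ¬ Q e C := by
      rintro C hC ⟨x, hx, y, hy, hxy⟩
      exact hMn ((bernProb_nonneg hp hp1 _ _).trans
        (hM x (Finset.mem_powerset.1 hC hx) y hy (hxy ▸ he)))
    rw [Finset.sum_eq_zero fun C hC => by simp [h1 C hC, bernProb, bern_const]]
    simp [h0, bernProb, bern_const]

/-- The differential inequality of Duminil-Copin and Tassion. -/
lemma le_sum_pivotal {p κ : ℝ} (hp : 0 ≤ p) (hp1 : p ≤ 1) (E : Finset (Sym2 V))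
    (L : Finset V) (v : V) (hκ : ∀ S ⊆ L, v ∈ S → κ ≤ cutSum p E S v) {A : Finset (Sym2 V) → Prop}
    (hA : ∀ ω, A ω ↔ ∃ y ∉ L, Conn ω v y) :
    κ * (1 - bernProb p E A) ≤ ∑ e ∈ E, bern p E (fun ω =>
      (if A (insert e ω) then (1 : ℝ) else 0) - if A (ω.erase e) then 1 else 0) := by
  -- When `A` fails, sort the configurations by the set `S` of vertices not joined to the complement
  -- of `L`; it contains `v`.
  have h1 : 1 - bernProb p E A ≤ ∑ S ∈ L.powerset.filter (v ∈ ·),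
      bernProb p E (fun ω => IsSeparated L S (ω : Set (Sym2 V))) := by
    rw [← bernProb_not]
    refine bernProb_le_sum hp hp1 _ fun ω _ hω => ?_
    have hS : IsSeparated (L : Set V)
        ((L.filter fun x => ¬ ∃ y ∉ L, Conn (ω : Set (Sym2 V)) x y : Finset V) : Set V) ω := by
      intro x
      simp only [Finset.coe_filter, Set.mem_ofPred_eq]
      refine ⟨fun h => h.2, fun h => ⟨?_, h⟩⟩
      by_contra hL
      exact h ⟨x, hL, Conn.refl _ _⟩
    refine ⟨_, ?_, hS⟩
    simp only [Finset.mem_filter, Finset.mem_powerset]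
    rw [hA] at hω
    exact ⟨Finset.filter_subset _ _, by_contra fun hL => hω ⟨v, hL, Conn.refl _ _⟩, hω⟩
  have hind : ∀ S : Finset V, ∀ e, bernProb p E (fun ω => IsSeparated L S (ω : Set (Sym2 V)) ∧
      LeadsOut S v e (ω : Set (Sym2 V))) = bernProb p E (fun ω => IsSeparated L S (ω : Set (Sym2 V))) *
        bernProb p E (fun ω => LeadsOut S v e (ω : Set (Sym2 V))) := by
    intro S e
    refine bernProb_and (inside (S : Set V))ᶜ E ?_ ?_
    · intro e' he' ω
      have he'' : e' ∈ inside (S : Set V) := not_not.1 he'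
      have hne : ∀ f ∉ inside (S : Set V), f ≠ e' := fun f hf h => hf (h ▸ he'')
      constructor
      · refine fun h => h.of_agree (fun f hf hfω => ?_) (fun f _ hfω => ?_)
        · simpa [hne f hf] using hfω
        · simpa using Or.inr hfω
      · refine fun h => h.of_agree (fun f _ hfω => ?_) (fun f hf hfω => ?_)
        · simpa using Or.inr hfω
        · simpa [hne f hf] using hfω
    · intro e' he' ω
      have : ((insert e' ω : Finset (Sym2 V)) : Set (Sym2 V)) ∩ inside (S : Set V) =
          (ω : Set (Sym2 V)) ∩ inside (S : Set V) := by
        rw [Finset.coe_insert, Set.insert_inter_of_notMem he']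
      unfold LeadsOut
      rw [this]
  calc κ * (1 - bernProb p E A)
      ≤ ∑ S ∈ L.powerset.filter (v ∈ ·), bernProb p E (fun ω => IsSeparated L S (ω : Set (Sym2 V))) *
          cutSum p E S v := by
        rcases le_total 0 κ with h0 | h0
        · refine (mul_le_mul_of_nonneg_left h1 h0).trans ?_
          rw [Finset.mul_sum]
          refine Finset.sum_le_sum fun S hS => ?_
          rw [mul_comm]
          simp only [Finset.mem_filter, Finset.mem_powerset] at hS
          exact mul_le_mul_of_nonneg_left (hκ S hS.1 hS.2) (bernProb_nonneg hp hp1 _ _)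
        · refine le_trans (mul_nonpos_of_nonpos_of_nonneg h0
            (by linarith [bernProb_le_one hp hp1 E A])) ?_
          exact Finset.sum_nonneg fun S _ => mul_nonneg (bernProb_nonneg hp hp1 _ _)
            (Finset.sum_nonneg fun e _ => bernProb_nonneg hp hp1 _ _)
    _ = ∑ e ∈ E, ∑ S ∈ L.powerset.filter (v ∈ ·), bernProb p E (fun ω => IsSeparated L S (ω : Set (Sym2 V)) ∧
          LeadsOut S v e (ω : Set (Sym2 V))) := by
        rw [Finset.sum_comm]
        refine Finset.sum_congr rfl fun S _ => ?_
        simp only [cutSum, Finset.mul_sum, hind]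
    _ ≤ _ := by
        refine Finset.sum_le_sum fun e _ => ?_
        unfold bernProb
        rw [← bern_sum]
        refine bern_mono hp hp1 fun ω _ => ?_
        -- At most one `S` contributes, since `ω` determines it. For that `S` the edge is pivotal:
        -- its outer endpoint is joined to the complement of `L`, its inner one to `v`, while `v` is
        -- not joined to the complement in `ω`.
        refine (sum_ite_le_ite (A := A (insert e ω) ∧ ¬ A (ω.erase e)) _ ?_ ?_).trans ?_
        · rintro S hS ⟨hsep, x, hx, y, hy, rfl, hc⟩
          simp only [Finset.mem_filter, Finset.mem_powerset] at hS
          constructor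
          · have hy' : ∃ z ∉ (L : Set V), Conn (ω : Set (Sym2 V)) y z := by
              by_contra h; exact hy ((hsep y).2 h)
            obtain ⟨z, hz, hyz⟩ := hy'
            have hsub : (ω : Set (Sym2 V)) ⊆ (insert s(x, y) ω : Finset (Sym2 V)) := by
              simp
            rw [hA]
            refine ⟨z, hz, ?_⟩
            exact ((hc.mono (Set.inter_subset_left.trans hsub)).trans
              (Conn.single (by simp))).trans (hyz.mono hsub)
          · rw [hA]
            rintro ⟨z, hz, hvz⟩
            exact (hsep v).1 hS.2 ⟨z, hz, hvz.mono (by simp)⟩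
        · rintro S _ S' _ ⟨h, _⟩ ⟨h', _⟩
          ext x
          have := (h x).trans (h' x).symm
          simpa using this
        · by_cases h2 : A (insert e ω) <;> by_cases h3 : A (ω.erase e) <;> simp [h2, h3]
          have : A (insert e ω) := by
            rw [hA] at h3 ⊢
            obtain ⟨y, hy, hc⟩ := h3
            refine ⟨y, hy, hc.mono ?_⟩
            have := (Finset.erase_subset e ω).trans (Finset.subset_insert e ω)
            exact_mod_cast this
          exact absurd this h2

/-- Otherwise all cut sums exceed `1/2` at `p`, hence at every larger parameter. With `θ` the exit
probability, `le_sum_pivotal` gives `θ' ≥ (1 - θ) / 2 ≥ 3/8` on `(p, q)`, because `θ ≤ 1/4` there.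
The mean value theorem then yields `θ(q) ≥ 3 (q - p) / 8`, against the assumed bound `(q - p) / 4`.
-/
lemma exists_cutSum_le_half {p q : ℝ} (hp : 0 ≤ p) (hpq : p < q) (hq : q ≤ 1)
    (E : Finset (Sym2 V)) (L : Finset V) (v : V)
    (h : bernProb q E (fun ω => ∃ y ∉ L, Conn ω v y) < (q - p) / 4) :
    ∃ S ⊆ L, v ∈ S ∧ cutSum p E S v ≤ 1 / 2 := by
  by_contra hn
  push Not at hn
  set A : Finset (Sym2 V) → Prop := fun ω => ∃ y ∉ L, Conn ω v y with hA
  have hmono : ∀ ω ω' : Finset (Sym2 V), ω ⊆ ω' → A ω → A ω' := fun ω ω' h ⟨y, hy, hc⟩ =>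
    ⟨y, hy, hc.mono (by exact_mod_cast h)⟩
  obtain ⟨r, hr, hder⟩ := exists_hasDerivAt_eq_slope (fun x => bernProb x E A) _ hpq
    (fun x _ => (hasDerivAt_bern E (fun ω => if A ω then 1 else 0) x).continuousAt
      |>.continuousWithinAt)
    (fun x _ => hasDerivAt_bern E (fun ω => if A ω then 1 else 0) x)
  have hr0 : 0 ≤ r := hp.trans hr.1.le
  have hr1 : r ≤ 1 := hr.2.le.trans hq
  have h1 := le_sum_pivotal (κ := 1 / 2) hr0 hr1 E L v (fun S hS hv => by
    refine (hn S hS hv).le.trans (Finset.sum_le_sum fun e _ => ?_)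
    exact bernProb_mono_param hp hr.1.le hr1 E
      fun ω ω' h hl => hl.mono (by exact_mod_cast h)) (A := A) (fun ω => Iff.rfl)
  replace h1 := h1.trans_eq hder
  have h2 : bernProb r E A ≤ bernProb q E A := bernProb_mono_param hr0 hr.2.le hq E hmono
  have h3 := bernProb_nonneg hp (hpq.le.trans hq) E A
  have h4 : 0 < q - p := by linarith
  rw [le_div_iff₀ h4] at h1
  have : bernProb r E A ≤ 1 / 4 := by linarith
  nlinarith

/-- Exponential decay of the radius of clusters in a finite graph, under uniform smallness of the
probability to reach distance `n` at a larger parameter. -/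
theorem bernProb_radius_le {p q : ℝ} (hp : 0 ≤ p) (hpq : p < q) (hq : q ≤ 1)
    (E : Finset (Sym2 V)) (W : Finset V) (hEW : ∀ e ∈ E, ∀ x ∈ e, x ∈ W) {n b : ℝ} (hn : 0 < n)
    (hb0 : 0 ≤ b) (ρ : V → V → ℝ) (htri : ∀ x y z, ρ x z ≤ ρ x y + ρ y z)
    (hb : ∀ x y, s(x, y) ∈ E → ρ x y ≤ b)
    (h : ∀ v ∈ W, bernProb q E (fun ω => ∃ y, n ≤ ρ v y ∧ Conn ω v y) < (q - p) / 4)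
    (k : ℕ) : ∀ v ∈ W, bernProb p E (fun ω => ∃ y, k * (n + b) ≤ ρ v y ∧ Conn ω v y) ≤
      (1 / 2) ^ k := by
  have hp1 : p ≤ 1 := hpq.le.trans hq
  induction k with
  | zero => exact fun v _ => by simpa using bernProb_le_one hp hp1 E _
  | succ k ih =>
    intro v hv
    have hmem : ∀ ω ⊆ E, ∀ y, Conn (ω : Set (Sym2 V)) v y → y ∈ W := by
      intro ω hω y hc
      induction hc with
      | refl => exact hv
      | @tail a c _ hac _ => exact hEW _ (hω hac) c (by simp)
    -- Open paths from `v` stay in `W`, so leaving the filtered set means reaching distance `n`.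
    have hout : bernProb q E (fun ω => ∃ y ∉ W.filter fun x => ρ v x < n, Conn ω v y) <
        (q - p) / 4 := by
      refine lt_of_le_of_lt (bernProb_mono (hp.trans hpq.le) hq ?_) (h v hv)
      rintro ω hω ⟨y, hy, hc⟩
      exact ⟨y, by simpa [hmem ω hω y hc] using hy, hc⟩
    obtain ⟨S, hSL, hvS, hcut⟩ := exists_cutSum_le_half hp hpq hq E _ v hout
    have hS : ∀ x ∈ S, ρ v x < n := fun x hx => (Finset.mem_filter.1 (hSL hx)).2
    have hnb : n ≤ ((k + 1 : ℕ) : ℝ) * (n + b) := by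
      push_cast
      nlinarith [mul_nonneg (Nat.cast_nonneg (α := ℝ) k) (add_nonneg hn.le hb0)]
    -- Leaving `S` covers less than `n`, and the exit edge at most `b`; a distance `k * (n + b)`
    -- remains to be covered from the outer endpoint.
    have h1 := bernProb_conn_le_cutSum hp hp1 E S hvS {y | ((k + 1 : ℕ) : ℝ) * (n + b) ≤ ρ v y}
      (fun t ht htS => absurd (hS t htS) (not_lt.2 (hnb.trans ht))) (M := (1 / 2) ^ k) (by
        intro x hx y _ hxy
        refine le_trans (bernProb_mono hp hp1 ?_) (ih y (hEW _ hxy y (by simp)))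
        rintro ω _ ⟨t, ht, hc⟩
        refine ⟨t, ?_, hc⟩
        have h2 := htri v x t
        have h3 := htri x y t
        have h4 := hb x y hxy
        have h5 := hS x hx
        simp only [Set.mem_ofPred_eq] at ht
        push_cast at ht
        linarith)
    refine h1.trans ?_
    rw [pow_succ']
    exact mul_le_mul_of_nonneg_right hcut (by positivity)

end Sharpness

/-! ### Bernoulli percolation on infinite sets of edges -/

section Infinite

open scoped Classical
open ProbabilityTheory

lemma bern_map {α β : Type*} (f : α ↪ β) (p : ℝ) (J : Finset α) (g : Finset β → ℝ) :
    bern p (J.map f) g = bern p J fun ω => g (ω.map f) := by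
  induction J using Finset.induction_on generalizing g with
  | empty => simp [bern_empty]
  | insert e J he ih =>
    rw [Finset.map_insert, bern_insert p (by simpa using he), bern_insert p he, ih, ih]
    simp only [Finset.map_insert]

variable {ι : Type*}

lemma filter_mem_eq_iff {J A : Finset ι} (hA : A ⊆ J) (ω : Set ι) :
    J.filter (· ∈ ω) = A ↔ ∀ i ∈ J, (i ∈ ω ↔ i ∈ A) := by
  simp only [Finset.ext_iff, Finset.mem_filter]
  refine ⟨fun h i hi => by simpa [hi] using h i, fun h i => ?_⟩
  by_cases hi : i ∈ J
  · simpa [hi] using h i hi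
  · simpa [hi] using fun h => hi (hA h)

lemma measurableSet_filter_mem_eq {J A : Finset ι} (hA : A ⊆ J) :
    MeasurableSet {ω : Set ι | J.filter (· ∈ ω) = A} := by
  simp only [filter_mem_eq_iff hA]
  have : {ω : Set ι | ∀ i ∈ J, (i ∈ ω ↔ i ∈ A)} = ⋂ i ∈ J, {ω : Set ι | i ∈ ω ↔ i ∈ A} := by
    ext; simp
  rw [this]
  refine Finset.measurableSet_biInter _ fun i _ => ?_
  by_cases hi : i ∈ A
  · simpa [hi] using measurableSet_mem i
  · simpa [hi] using measurable_set_notMem i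

lemma setBernoulli_filter_eq (p : unitInterval) {J A : Finset ι} (hA : A ⊆ J) :
    setBernoulli Set.univ p {ω : Set ι | J.filter (· ∈ ω) = A} =
      ENNReal.ofReal ((p : ℝ) ^ A.card * (1 - p : ℝ) ^ (J.card - A.card)) := by
  rw [setBernoulli_apply']
  have h1 : ((fun p : ι → Prop => {i | p i}) ⁻¹' {ω : Set ι | J.filter (· ∈ ω) = A}) =
      Set.pi J fun i => {q : Prop | q ↔ i ∈ A} := by
    ext P
    exact filter_mem_eq_iff hA {i | P i}
  have h2 : ∀ i ∈ J, ((unitInterval.toNNReal p • Measure.dirac (i ∈ (Set.univ : Set ι)) +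
      unitInterval.toNNReal (unitInterval.symm p) • Measure.dirac False : Measure Prop)
        {q : Prop | q ↔ i ∈ A}) =
      if i ∈ A then ENNReal.ofReal p else ENNReal.ofReal (1 - p) := by
    have h3 : ∀ x : unitInterval, (unitInterval.toNNReal x : ENNReal) = ENNReal.ofReal x :=
      fun x => by
        rw [ENNReal.ofReal, Real.toNNReal_of_nonneg x.2.1]; rfl
    intro i _
    by_cases hi : i ∈ A <;> simp [hi, h3, ENNReal.smul_def]
  rw [h1, Measure.infinitePi_pi _ (fun _ _ => MeasurableSet.of_discrete), Finset.prod_congr rfl h2,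
    Finset.prod_ite, Finset.prod_const, Finset.prod_const]
  have h3 : J.filter (· ∈ A) = A := by ext i; simpa using fun h => hA h
  have h4 : J.filter (· ∉ A) = J \ A := by ext i; simp
  rw [h3, h4, Finset.card_sdiff_of_subset hA,
    ENNReal.ofReal_mul (pow_nonneg p.2.1 _), ENNReal.ofReal_pow p.2.1,
    ENNReal.ofReal_pow (by linarith [p.2.2])]

/-- The bridge that carries the finite-graph estimates over to the infinite product measure. -/
lemma setBernoulli_finite (p : unitInterval) (J : Finset ι) (Q : Finset ι → Prop) :
    setBernoulli Set.univ p {ω : Set ι | Q (J.filter (· ∈ ω))} =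
      ENNReal.ofReal (bernProb p J Q) := by
  have h1 : {ω : Set ι | Q (J.filter (· ∈ ω))} =
      ⋃ A ∈ J.powerset.filter Q, {ω : Set ι | J.filter (· ∈ ω) = A} := by
    ext ω; simp [Finset.filter_subset]
  have hp : 0 ≤ 1 - (p : ℝ) := by linarith [p.2.2]
  rw [h1, measure_biUnion_finset, bernProb, bern,
    ENNReal.ofReal_sum_of_nonneg, Finset.sum_filter]
  · refine Finset.sum_congr rfl fun A hA => ?_
    split_ifs
    · rw [setBernoulli_filter_eq p (Finset.mem_powerset.1 hA), mul_one]
    · simp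
  · intro A _
    have := p.2.1
    split_ifs <;> positivity
  · intro A _ B _ hAB
    refine Set.disjoint_left.2 fun ω hA hB => hAB (hA.symm.trans hB)
  · exact fun A hA => measurableSet_filter_mem_eq
      (Finset.mem_powerset.1 (Finset.mem_filter.1 hA).1)

/-- Permuting the coordinates does not change the law of a Bernoulli set. -/
lemma setBernoulli_preimage_perm (p : unitInterval) (e : Equiv.Perm ι) (A : Set (Set ι)) :
    setBernoulli Set.univ p {ω : Set ι | e ⁻¹' ω ∈ A} = setBernoulli Set.univ p A := by
  have h := Measure.infinitePi_map_piCongrLeft (fun _ : ι =>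
    unitInterval.toNNReal p • Measure.dirac True +
      unitInterval.toNNReal (unitInterval.symm p) • Measure.dirac False) e.symm
  rw [setBernoulli_apply', setBernoulli_apply']
  simp only [Set.mem_univ]
  conv_rhs => rw [← h, MeasurableEquiv.map_apply]
  congr 1
  ext P
  have : (MeasurableEquiv.piCongrLeft (fun _ => Prop) e.symm) P = fun i => P (e i) := by
    funext i
    have := MeasurableEquiv.piCongrLeft_apply_apply (β := fun _ => Prop) e.symm P (e i)
    rwa [Equiv.symm_apply_apply] at this
  simp only [Set.mem_preimage, this]
  rfl

variable {V : Type*}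

lemma Conn.exists_finset {f : ι → Sym2 V} {ω : Set ι} {x y : V} (hc : Conn (f '' ω) x y) :
    ∃ A : Finset ι, (A : Set ι) ⊆ ω ∧ Conn (f '' A) x y := by
  induction hc with
  | refl => exact ⟨∅, by simp, Conn.refl _ _⟩
  | @tail a b _ hab ih =>
    obtain ⟨A, hA, hc⟩ := ih
    obtain ⟨i, hi, hab⟩ := hab
    refine ⟨insert i A, by simp [Set.insert_subset_iff, hi, hA], ?_⟩
    exact (hc.mono (Set.image_mono (by simp))).trans (Conn.single ⟨i, by simp, hab⟩)

lemma measurableSet_conn [Countable ι] (f : ι → Sym2 V) (x y : V) :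
    MeasurableSet {ω : Set ι | Conn (f '' ω) x y} := by
  have : {ω : Set ι | Conn (f '' ω) x y} = ⋃ A ∈ {A : Finset ι | Conn (f '' A) x y},
      ⋂ i ∈ A, {ω : Set ι | i ∈ ω} := by
    ext ω
    simp only [Set.mem_ofPred_eq, Set.mem_iUnion, Set.mem_iInter, exists_prop]
    exact ⟨fun h => by obtain ⟨A, hA, hc⟩ := h.exists_finset; exact ⟨A, hc, fun i hi => hA hi⟩,
      fun ⟨A, hc, hA⟩ => hc.mono (Set.image_mono hA)⟩
  rw [this]
  exact MeasurableSet.biUnion (Set.to_countable _) fun A _ =>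
    Finset.measurableSet_biInter _ fun i _ => measurableSet_mem i

/-- Exponential decay of the radius of the clusters in the subgraph with edges in `R`. -/
theorem setBernoulli_radius_le [Countable ι] {p q : unitInterval} (hpq : p < q)
    (f : ι ↪ Sym2 V) (R : Set (Sym2 V)) (W : Set V) (hRW : R ⊆ inside W) {n b : ℝ} (hn : 0 < n)
    (hb0 : 0 ≤ b) (ρ : V → V → ℝ) (htri : ∀ x y z, ρ x z ≤ ρ x y + ρ y z)
    (hb : ∀ i x y, f i = s(x, y) → s(x, y) ∈ R → ρ x y ≤ b)
    (h : ∀ v ∈ W, setBernoulli Set.univ q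
      {ω : Set ι | ∃ y ∈ W, n ≤ ρ v y ∧ Conn (f '' ω) v y} < ENNReal.ofReal ((q - p) / 4))
    (k : ℕ) (v : V) (hv : v ∈ W) : setBernoulli Set.univ p
      {ω : Set ι | ∃ y, k * (n + b) ≤ ρ v y ∧ Conn (f '' ω ∩ R) v y} ≤
        ENNReal.ofReal ((1 / 2) ^ k) := by
  have hpq' : (p : ℝ) < q := hpq
  let J : Finset ι → Finset ι := fun A => A.filter fun i => f i ∈ R
  have himg : ∀ (A : Finset ι) (ω : Set ι),
      ((((J A).filter (· ∈ ω)).map f : Finset (Sym2 V)) : Set (Sym2 V)) =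
        f '' (A ∩ ω) ∩ R := by
    intro A ω
    ext e
    simp only [J, Finset.coe_map, Set.mem_image, Finset.mem_coe, Finset.mem_filter, Set.mem_inter_iff]
    constructor
    · rintro ⟨i, ⟨⟨h1, h2⟩, h3⟩, rfl⟩; exact ⟨⟨i, ⟨h1, h3⟩, rfl⟩, h2⟩
    · rintro ⟨⟨i, ⟨h1, h3⟩, rfl⟩, h2⟩; exact ⟨i, ⟨⟨h1, h2⟩, h3⟩, rfl⟩
  have hprob : ∀ (r : unitInterval) (A : Finset ι) (Q : Set (Sym2 V) → Prop),
      setBernoulli Set.univ r {ω : Set ι | Q (f '' (A ∩ ω) ∩ R)} =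
        ENNReal.ofReal (bernProb r ((J A).map f) fun ω => Q ω) := by
    intro r A Q
    simp only [← himg]
    rw [setBernoulli_finite r (J A) fun ω => Q ((ω.map f : Finset (Sym2 V)) : Set (Sym2 V))]
    rw [bernProb, bernProb, bern_map]
  -- A path uses finitely many edges, so the event is a directed union of events on finite graphs,
  -- to which `bernProb_radius_le` applies with a bound independent of the graph.
  have hUn : {ω : Set ι | ∃ y, k * (n + b) ≤ ρ v y ∧ Conn (f '' ω ∩ R) v y} =
      ⋃ A : Finset ι, {ω : Set ι | ∃ y, k * (n + b) ≤ ρ v y ∧ Conn (f '' (A ∩ ω) ∩ R) v y} := by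
    ext ω
    simp only [Set.mem_ofPred_eq, Set.mem_iUnion]
    constructor
    · rintro ⟨y, hy, hc⟩
      have : f '' ω ∩ R = f '' (ω ∩ f ⁻¹' R) := by rw [Set.image_inter_preimage]
      rw [this] at hc
      obtain ⟨A, hA, hc⟩ := hc.exists_finset
      refine ⟨A, y, hy, hc.mono ?_⟩
      rintro _ ⟨i, hi, rfl⟩
      exact ⟨⟨i, ⟨hi, (hA hi).1⟩, rfl⟩, (hA hi).2⟩
    · rintro ⟨A, y, hy, hc⟩
      exact ⟨y, hy, hc.mono (Set.inter_subset_inter_left _ (Set.image_mono Set.inter_subset_right))⟩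
  rw [hUn, Directed.measure_iUnion]
  · refine iSup_le fun A => ?_
    rw [hprob p A fun R' => ∃ y, k * (n + b) ≤ ρ v y ∧ Conn R' v y]
    refine ENNReal.ofReal_le_ofReal ?_
    set E := (J A).map f with hE
    have hER : ∀ e ∈ E, (∃ i, f i = e) ∧ e ∈ R := by
      intro e he
      obtain ⟨i, hi, rfl⟩ := Finset.mem_map.1 he
      exact ⟨⟨i, rfl⟩, (Finset.mem_filter.1 hi).2⟩
    let W' : Finset V := insert v (E.biUnion fun e => e.toFinset)
    have hW' : ∀ x ∈ W', x ∈ W := by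
      intro x hx
      rcases Finset.mem_insert.1 hx with rfl | hx
      · exact hv
      · obtain ⟨e, he, hxe⟩ := Finset.mem_biUnion.1 hx
        exact hRW (hER e he).2 x (by simpa using hxe)
    refine bernProb_radius_le p.2.1 hpq' q.2.2 E W' (fun e he x hx => ?_) hn hb0 ρ htri
      (fun x y he => ?_) (fun x hx => ?_) k v (Finset.mem_insert_self _ _)
    · exact Finset.mem_insert_of_mem (Finset.mem_biUnion.2 ⟨e, he, by simpa using hx⟩)
    · obtain ⟨⟨i, hi⟩, hR⟩ := hER _ he
      exact hb i x y hi hR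
    · rw [← ENNReal.ofReal_lt_ofReal_iff (by linarith),
        ← hprob q A fun R' => ∃ y, n ≤ ρ x y ∧ Conn R' x y]
      refine (measure_mono ?_).trans_lt (h x (hW' x hx))
      rintro ω ⟨y, hy, hc⟩
      refine ⟨y, ?_, hy, hc.mono (Set.inter_subset_left.trans
        (Set.image_mono Set.inter_subset_right))⟩
      exact (hc.mono (Set.inter_subset_inter_right _ hRW)).mem_of_inside (hW' x hx)
  · intro A B
    refine ⟨A ∪ B, ?_, ?_⟩ <;> rintro ω ⟨y, hy, hc⟩ <;>
      refine ⟨y, hy, hc.mono (Set.inter_subset_inter_left _ (Set.image_mono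
        (Set.inter_subset_inter_left _ ?_)))⟩ <;> simp

end Infinite

/-! ### Geometry of the ball model -/

namespace HypSpace

variable {d : ℕ}

/-- The quantity `1 - ‖x‖ ^ 2`, comparable to the Euclidean distance to the sphere at infinity. -/
def ht (x : HypSpace d) : ℝ := 1 - ‖(x : EuclideanSpace ℝ (Fin d))‖ ^ 2

/-- The square of the hyperbolic sine of half of the hyperbolic distance. -/
def sep (x y : HypSpace d) : ℝ :=
  ‖(x : EuclideanSpace ℝ (Fin d)) - y‖ ^ 2 / (ht x * ht y)

lemma norm_lt_one (x : HypSpace d) : ‖(x : EuclideanSpace ℝ (Fin d))‖ < 1 := by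
  exact mem_ball_zero_iff.1 x.2

lemma ht_pos (x : HypSpace d) : 0 < ht x := by
  have := norm_lt_one x
  have h0 := norm_nonneg (x : EuclideanSpace ℝ (Fin d))
  unfold ht; nlinarith

lemma ht_le_one (x : HypSpace d) : ht x ≤ 1 := by
  unfold ht; nlinarith [sq_nonneg ‖(x : EuclideanSpace ℝ (Fin d))‖]

lemma continuous_ht : Continuous (ht : HypSpace d → ℝ) := by
  unfold ht; fun_prop

lemma sep_nonneg (x y : HypSpace d) : 0 ≤ sep x y := by
  have := ht_pos x; have := ht_pos y
  unfold sep; positivity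

lemma sep_self (x : HypSpace d) : sep x x = 0 := by simp [sep]

lemma sep_comm (x y : HypSpace d) : sep x y = sep y x := by
  unfold sep; rw [norm_sub_rev, mul_comm]

lemma norm_sub_sq_eq (x y : HypSpace d) :
    ‖(x : EuclideanSpace ℝ (Fin d)) - y‖ ^ 2 = sep x y * (ht x * ht y) := by
  have := (ht_pos x).ne'; have := (ht_pos y).ne'
  unfold sep; field_simp

lemma continuous_sep (x : HypSpace d) : Continuous (sep x) := by
  unfold sep
  refine Continuous.div (by fun_prop) (continuous_const.mul continuous_ht) fun y => ?_
  exact (mul_pos (ht_pos x) (ht_pos y)).ne'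

lemma hdist_eq (x y : HypSpace d) : hdist x y = Real.arcosh (1 + 2 * sep x y) := by
  unfold hdist sep ht; rw [mul_div_assoc]

lemma one_le_one_add_sep (x y : HypSpace d) : 1 ≤ 1 + 2 * sep x y := by
  linarith [sep_nonneg x y]

lemma hdist_nonneg (x y : HypSpace d) : 0 ≤ hdist x y := by
  rw [hdist_eq]; exact Real.arcosh_nonneg (one_le_one_add_sep x y)

lemma hdist_self (x : HypSpace d) : hdist x x = 0 := by
  rw [hdist_eq, sep_self]; simp

lemma hdist_le_hdist_iff (x y z w : HypSpace d) : hdist x y ≤ hdist z w ↔ sep x y ≤ sep z w := by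
  rw [hdist_eq, hdist_eq, Real.arcosh_le_arcosh (by linarith [one_le_one_add_sep x y])
    (by linarith [one_le_one_add_sep z w])]
  constructor <;> intro h <;> linarith

lemma continuous_hdist (x : HypSpace d) : Continuous (hdist x) := by
  have : hdist x = fun y => Real.arcosh (1 + 2 * sep x y) := funext fun y => hdist_eq x y
  rw [this]
  exact Real.continuousOn_arcosh.comp_continuous
    (continuous_const.add (continuous_const.mul (continuous_sep x))) (one_le_one_add_sep x)

lemma hdist_comm (x y : HypSpace d) : hdist x y = hdist y x := by
  rw [hdist_eq, hdist_eq, sep_comm]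

lemma IsIsom.sep_eq {φ : Equiv.Perm (HypSpace d)} (h : IsIsom φ) (x y : HypSpace d) :
    sep (φ x) (φ y) = sep x y :=
  le_antisymm ((hdist_le_hdist_iff _ _ _ _).1 (h x y).le)
    ((hdist_le_hdist_iff _ _ _ _).1 (h x y).ge)

lemma left_mem_segment (x y : HypSpace d) : x ∈ segment x y := by
  simp [segment, hdist_self]

lemma segment_symm (x y : HypSpace d) : segment x y = segment y x := by
  ext z
  simp only [segment, Set.mem_ofPred_eq]
  rw [add_comm, hdist_comm z y, hdist_comm x z, hdist_comm x y]

lemma sep_le_of_mem_segment {x y z : HypSpace d} (h : z ∈ segment x y) : sep x z ≤ sep x y := by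
  have h' : hdist x z + hdist z y = hdist x y := h
  exact (hdist_le_hdist_iff _ _ _ _).1 (by linarith [hdist_nonneg z y])

lemma isClosed_segment (x y : HypSpace d) : IsClosed (segment x y) := by
  have : segment x y = {z | hdist x z + hdist y z = hdist x y} := by
    ext z; simp only [segment, Set.mem_ofPred_eq, hdist_comm y z]
  rw [this]
  exact isClosed_eq ((continuous_hdist x).add (continuous_hdist y)) continuous_const

/-- The heights of points at bounded distance are comparable. -/
lemma ht_le_mul_ht {x y : HypSpace d} {S : ℝ} (hS : sep x y ≤ S) : ht y ≤ (2 + 4 * S) * ht x := by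
  have hx := ht_pos x
  have hy := ht_pos y
  have h0 : 0 ≤ S := (sep_nonneg x y).trans hS
  by_contra hlt
  push Not at hlt
  have h1 : ht y - ht x ≤ 2 * ‖(x : EuclideanSpace ℝ (Fin d)) - y‖ := by
    have h2 := norm_sub_norm_le (x : EuclideanSpace ℝ (Fin d)) y
    have h3 := norm_lt_one x
    have h4 := norm_lt_one y
    have h5 := norm_nonneg (x : EuclideanSpace ℝ (Fin d))
    have h6 := norm_nonneg (y : EuclideanSpace ℝ (Fin d))
    have h7 := norm_nonneg ((x : EuclideanSpace ℝ (Fin d)) - y)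
    unfold ht
    nlinarith
  have h2 := norm_sub_sq_eq x y
  have h3 : 0 ≤ ht y - ht x := by nlinarith [mul_nonneg h0 hx.le]
  have h4 : (ht y - ht x) ^ 2 ≤ 4 * (sep x y * (ht x * ht y)) := by
    rw [← h2]; nlinarith
  have h5 : sep x y * (ht x * ht y) ≤ S * (ht x * ht y) :=
    mul_le_mul_of_nonneg_right hS (mul_pos hx hy).le
  -- Expanding the square gives `ht y ^ 2 + ht x ^ 2 ≤ (2 + 4 * S) * ht x * ht y`, whence the
  -- constant.
  nlinarith

lemma isCompact_le_ht {t : ℝ} (ht0 : 0 < t) : IsCompact {x : HypSpace d | t ≤ ht x} := by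
  rw [Subtype.isCompact_iff]
  have : ((↑) '' {x : HypSpace d | t ≤ ht x} : Set (EuclideanSpace ℝ (Fin d))) =
      {x | t ≤ 1 - ‖x‖ ^ 2} := by
    ext x
    simp only [Set.mem_image, Set.mem_ofPred_eq]
    constructor
    · rintro ⟨y, hy, rfl⟩; exact hy
    · intro hx
      have : ‖x‖ < 1 := by nlinarith [norm_nonneg x]
      exact ⟨⟨x, by simpa using this⟩, hx, rfl⟩
  rw [this]
  refine Metric.isCompact_of_isClosed_isBounded
    (isClosed_le continuous_const (by fun_prop)) ?_
  refine (Metric.isBounded_closedBall (x := (0 : EuclideanSpace ℝ (Fin d))) (r := 1)).subset ?_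
  intro x hx
  have hx' : t ≤ 1 - ‖x‖ ^ 2 := hx
  simp only [mem_closedBall_zero_iff]
  nlinarith [norm_nonneg x]

lemma exists_forall_le_ht {K : Set (HypSpace d)} (hK : IsCompact K) :
    ∃ t > 0, ∀ x ∈ K, t ≤ ht x := by
  rcases K.eq_empty_or_nonempty with rfl | hne
  · exact ⟨1, one_pos, by simp⟩
  · obtain ⟨x, _, hx⟩ := hK.exists_isMinOn hne continuous_ht.continuousOn
    exact ⟨ht x, ht_pos x, hx⟩

/-! ### Directions seen from a point, expressed by hyperbolic distances -/

/-- The origin of the ball model. -/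
def origin : HypSpace d := ⟨0, by simp⟩

/-- The points that seen from `v` are far away in a direction close to that of `w`. -/
def target (v w : HypSpace d) (ε : ℝ) : Set (HypSpace d) :=
  {x | sep x w ≤ ε * ((1 + sep x v) * (1 + sep w v)) ∧ 1 ≤ ε * (1 + sep x v)}

/-- Since `1 + sep` is the squared hyperbolic cosine of half the distance, the first condition in
`target` says roughly that the Gromov product of `x` and `w` at `v` is large, which is an
isometry-invariant notion of closeness of directions. -/
lemma IsIsom.mem_target_iff {φ : Equiv.Perm (HypSpace d)} (h : IsIsom φ) (v w x : HypSpace d)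
    (ε : ℝ) : φ x ∈ target (φ v) (φ w) ε ↔ x ∈ target v w ε := by
  simp only [target, Set.mem_ofPred_eq, h.sep_eq]

lemma one_add_sep (x v : HypSpace d) : 1 + sep x v =
    (ht x * ht v + ‖(x : EuclideanSpace ℝ (Fin d)) - v‖ ^ 2) / (ht x * ht v) := by
  have := (ht_pos x).ne'; have := (ht_pos v).ne'
  unfold sep; field_simp

/-- In a neighbourhood of the sphere at infinity, a point at large Euclidean distance from `v`
compared to the size of the neighbourhood is far away from `v` in the direction of the origin. -/
lemma mem_target_origin {x v : HypSpace d} {h n : ℝ} (hn : 0 < n) (hh : 0 < h) (hx : ht x ≤ h)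
    (hv : ht v ≤ h) (hxv : n * h ≤ ‖(x : EuclideanSpace ℝ (Fin d)) - v‖) :
    x ∈ target v origin (1 / n ^ 2) := by
  have hx0 := ht_pos x
  have hv0 := ht_pos v
  have h1 : ht (origin : HypSpace d) = 1 := by simp [ht, origin]
  have h2 : ‖(x : EuclideanSpace ℝ (Fin d))‖ ≤ 1 := (norm_lt_one x).le
  have h3 : (n * h) ^ 2 ≤ ‖(x : EuclideanSpace ℝ (Fin d)) - v‖ ^ 2 :=
    pow_le_pow_left₀ (by positivity) hxv 2
  set N := ht x * ht v + ‖(x : EuclideanSpace ℝ (Fin d)) - v‖ ^ 2 with hN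
  -- Both conditions of `target` reduce to this inequality, as all heights involved are at most `h`
  -- and `1 + sep origin v = 1 / ht v`.
  have hNn : h ^ 2 ≤ N / n ^ 2 := by
    rw [le_div_iff₀ (by positivity)]; nlinarith [mul_pos hx0 hv0]
  have h4 : 1 + sep origin v = 1 / ht v := by
    rw [one_add_sep, h1]
    congr 1
    · simp [ht, origin]
    · simp
  have h5 : sep x origin = ‖(x : EuclideanSpace ℝ (Fin d))‖ ^ 2 / ht x := by
    rw [sep, h1]; simp [origin]
  refine ⟨?_, ?_⟩
  · rw [h4, h5, one_add_sep, ← hN]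
    have h6 : 1 / n ^ 2 * (N / (ht x * ht v) * (1 / ht v)) = (N / n ^ 2 / ht v ^ 2) / ht x := by
      field_simp
    rw [h6]
    gcongr
    rw [le_div_iff₀ (by positivity)]
    have : ‖(x : EuclideanSpace ℝ (Fin d))‖ ^ 2 ≤ 1 := by nlinarith [norm_nonneg (x : EuclideanSpace ℝ (Fin d))]
    have : ht v ^ 2 ≤ h ^ 2 := pow_le_pow_left₀ hv0.le hv 2
    nlinarith [sq_nonneg (ht v)]
  · rw [one_add_sep, ← hN]
    have h6 : 1 / n ^ 2 * (N / (ht x * ht v)) = N / n ^ 2 / (ht x * ht v) := by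
      field_simp
    rw [h6, le_div_iff₀ (by positivity)]
    nlinarith

/-- The `5` is `1 + 2 ^ 2`: heights are at most `1` and Euclidean distances at most `2`. -/
lemma one_add_sep_le (x v : HypSpace d) : 1 + sep x v ≤ 5 / (ht x * ht v) := by
  have hx0 := ht_pos x
  have hv0 := ht_pos v
  rw [one_add_sep]
  gcongr
  have h1 := norm_sub_le (x : EuclideanSpace ℝ (Fin d)) v
  have h2 := norm_lt_one x
  have h3 := norm_lt_one v
  have h4 := norm_nonneg ((x : EuclideanSpace ℝ (Fin d)) - v)
  have h5 := ht_le_one x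
  have h6 := ht_le_one v
  nlinarith

/-- As `ε → 0` with `v` fixed, targets shrink to `w` in the Euclidean metric and approach the
sphere, uniformly in `w`. The `25` is the square of the `5` in `one_add_sep_le`. -/
lemma norm_sub_le_of_mem_target {v w x : HypSpace d} {ε : ℝ} (hε : 0 ≤ ε)
    (hx : x ∈ target v w ε) :
    ‖(x : EuclideanSpace ℝ (Fin d)) - w‖ ^ 2 ≤ 25 / ht v ^ 2 * ε ∧ ht x ≤ 25 / ht v ^ 2 * ε := by
  have hx0 := ht_pos x
  have hv0 := ht_pos v
  have hw0 := ht_pos w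
  obtain ⟨h1, h2⟩ := hx
  constructor
  · have h3 : (1 + sep x v) * (1 + sep w v) ≤ 5 / (ht x * ht v) * (5 / (ht w * ht v)) :=
      mul_le_mul (one_add_sep_le x v) (one_add_sep_le w v) (by linarith [sep_nonneg w v])
        (by positivity)
    have h4 := h1.trans (mul_le_mul_of_nonneg_left h3 hε)
    rw [norm_sub_sq_eq]
    refine (mul_le_mul_of_nonneg_right h4 (by positivity)).trans_eq ?_
    field_simp
    norm_num
  · have h3 := h2.trans (mul_le_mul_of_nonneg_left (one_add_sep_le x v) hε)
    have h4 : ε * (5 / (ht x * ht v)) = (5 * ε / ht v) / ht x := by field_simp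
    rw [h4, le_div_iff₀ hx0, one_mul] at h3
    refine h3.trans ?_
    rw [div_mul_eq_mul_div, div_le_div_iff₀ hv0 (by positivity)]
    nlinarith [ht_le_one v, mul_nonneg hε hv0.le, mul_nonneg (mul_nonneg hε hv0.le) (sub_nonneg.2 (ht_le_one v))]

end HypSpace

/-! ### Graphs with a transitive action by isometries -/

namespace HypGraph

open HypSpace Filter Topology

variable {d : ℕ} (G : HypGraph d)

/-- The inclusion of the set of edges into the unordered pairs of vertices. -/
def edgeEmb : G.graph.edgeSet ↪ Sym2 G.verts := Function.Embedding.subtype _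

variable {G}

lemma countable_verts (hfin : G.IsLocallyFinite) : Countable G.verts := by
  have h : G.verts = ⋃ n : ℕ, G.verts ∩ {x | 1 / ((n : ℝ) + 1) ≤ ht x} := by
    ext x
    simp only [Set.mem_iUnion, Set.mem_inter_iff, Set.mem_ofPred_eq, exists_and_left,
      iff_self_and]
    intro _
    obtain ⟨n, hn⟩ := exists_nat_one_div_lt (ht_pos x)
    exact ⟨n, hn.le⟩
  rw [h]
  refine Set.Countable.to_subtype (Set.countable_iUnion fun n => ?_)
  exact ((hfin _ (isCompact_le_ht (by positivity))).1).countable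

lemma mem_edgeSegment {u v : G.verts} {z : HypSpace d} :
    z ∈ G.edgeSegment s(u, v) ↔ z ∈ segment (u : HypSpace d) v := by
  constructor
  · rintro ⟨a, b, hab, hz⟩
    rcases Sym2.eq_iff.1 hab with ⟨rfl, rfl⟩ | ⟨rfl, rfl⟩
    · exact hz
    · rwa [HypSpace.segment_symm]
  · exact fun hz => ⟨u, v, rfl, hz⟩

lemma exists_isom (htrans : G.IsTransitiveUnderIsometries) (o v : G.verts) :
    ∃ (φ : Equiv.Perm (HypSpace d)) (σ : G.graph ≃g G.graph), IsIsom φ ∧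
      (∀ u : G.verts, (σ u : HypSpace d) = φ u) ∧ σ o = v := by
  obtain ⟨Γ, hΓ, ht⟩ := htrans
  obtain ⟨φ, hφ, hov⟩ := ht o v
  obtain ⟨hi, σ, hσ⟩ := hΓ φ hφ
  exact ⟨φ, σ, hi, hσ, Subtype.ext ((hσ o).trans hov)⟩

lemma finite_neighbors (hfin : G.IsLocallyFinite) (o : G.verts) : {u | G.graph.Adj o u}.Finite := by
  refine Set.Finite.of_finite_image (f := fun u => s(o, u))
    ((hfin {(o : HypSpace d)} isCompact_singleton).2.subset ?_) ?_
  · rintro _ ⟨u, hu, rfl⟩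
    exact ⟨hu, o, mem_edgeSegment.2 (left_mem_segment _ _), rfl⟩
  · intro u _ v _ h
    exact Sym2.congr_right.1 h

/-- The edges have bounded length. -/
lemma exists_forall_adj_sep_le (hfin : G.IsLocallyFinite) (htrans : G.IsTransitiveUnderIsometries)
    (o : G.verts) : ∃ S, 0 ≤ S ∧ ∀ u v : G.verts, G.graph.Adj u v → sep (u : HypSpace d) v ≤ S := by
  obtain ⟨S, hS⟩ := ((finite_neighbors hfin o).image
    fun u : G.verts => sep (o : HypSpace d) u).bddAbove
  refine ⟨max S 0, le_max_right _ _, fun u v huv => ?_⟩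
  obtain ⟨φ, σ, hi, hσ, ho⟩ := exists_isom htrans o u
  have h1 : sep (u : HypSpace d) v = sep (o : HypSpace d) (σ.symm v : G.verts) := by
    rw [← hi.sep_eq (o : HypSpace d), ← hσ, ← hσ, ho, RelIso.apply_symm_apply]
  rw [h1]
  refine le_max_of_le_left (hS ⟨σ.symm v, ?_, rfl⟩)
  have : G.graph.Adj (σ o) (σ (σ.symm v)) := by rwa [ho, RelIso.apply_symm_apply]
  exact σ.map_adj_iff.1 this

/-- Distinct vertices are uniformly separated. -/
lemma exists_forall_ne_le_sep (hfin : G.IsLocallyFinite) (htrans : G.IsTransitiveUnderIsometries)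
    (o : G.verts) : ∃ r > 0, ∀ u v : G.verts, u ≠ v → r ≤ sep (u : HypSpace d) v := by
  set K := {x : HypSpace d | ht (o : HypSpace d) / 2 ≤ ht x} with hKdef
  have hK : IsCompact K := isCompact_le_ht (half_pos (ht_pos _))
  have hKo : K ∈ 𝓝 (o : HypSpace d) :=
    continuous_ht.continuousAt.eventually_const_le (half_lt_self (ht_pos _))
  have hfinK := (hfin K hK).1
  have hnhds : K \ ((G.verts ∩ K) \ {(o : HypSpace d)}) ∈ 𝓝 (o : HypSpace d) := by
    refine Filter.inter_mem hKo ?_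
    exact ((hfinK.subset Set.sdiff_subset).isClosed.isOpen_compl.mem_nhds (by simp))
  obtain ⟨r, hr, hball⟩ := Metric.mem_nhds_iff.1 hnhds
  refine ⟨r ^ 2, by positivity, fun u v huv => ?_⟩
  obtain ⟨φ, σ, hi, hσ, ho⟩ := exists_isom htrans o u
  have h1 : sep (u : HypSpace d) v = sep (o : HypSpace d) (σ.symm v : G.verts) := by
    rw [← hi.sep_eq (o : HypSpace d), ← hσ, ← hσ, ho, RelIso.apply_symm_apply]
  have hne : σ.symm v ≠ o := fun h => huv (by rw [← ho, ← h, RelIso.apply_symm_apply])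
  set w := σ.symm v
  rw [h1]
  have h2 : r ≤ dist (w : HypSpace d) o := by
    by_contra hlt
    push Not at hlt
    have := hball (Metric.mem_ball.2 hlt)
    exact this.2 ⟨⟨w.2, this.1⟩, fun h => hne (Subtype.ext h)⟩
  rw [dist_comm, Subtype.dist_eq, dist_eq_norm] at h2
  have h3 : r ^ 2 ≤ ‖((o : HypSpace d) : EuclideanSpace ℝ (Fin d)) - (w : HypSpace d)‖ ^ 2 :=
    pow_le_pow_left₀ hr.le h2 2
  rw [norm_sub_sq_eq] at h3
  have h4 := ht_pos (o : HypSpace d)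
  have h5 := ht_pos (w : HypSpace d)
  -- Heights are at most `1`, so `sep` dominates the squared Euclidean distance.
  have h6 : ht (o : HypSpace d) * ht (w : HypSpace d) ≤ 1 :=
    mul_le_one₀ (ht_le_one _) h5.le (ht_le_one _)
  nlinarith [sep_nonneg (o : HypSpace d) w]

/-! ### Percolation on the embedded graph -/

lemma openGraph_adj {ω : Set G.graph.edgeSet} {u v : G.verts} :
    (G.openGraph ω).Adj u v ↔ s(u, v) ∈ G.edgeEmb '' ω := by
  rw [openGraph, SimpleGraph.fromEdgeSet_adj]
  refine ⟨fun h => h.1, fun h => ⟨h, ?_⟩⟩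
  obtain ⟨e, _, he⟩ := h
  have : s(u, v) ∈ G.graph.edgeSet := he ▸ e.2
  exact (G.graph.mem_edgeSet.1 this).ne

lemma adj_of_mem_image {ω : Set G.graph.edgeSet} {u v : G.verts}
    (h : s(u, v) ∈ G.edgeEmb '' ω) : G.graph.Adj u v := by
  obtain ⟨e, _, he⟩ := h
  exact G.graph.mem_edgeSet.1 (he ▸ e.2)

lemma reachable_iff_conn {ω : Set G.graph.edgeSet} {u v : G.verts} :
    (G.openGraph ω).Reachable u v ↔ Conn (G.edgeEmb '' ω) u v := by
  rw [SimpleGraph.reachable_iff_reflTransGen]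
  have : (G.openGraph ω).Adj = fun a b => s(a, b) ∈ G.edgeEmb '' ω := by
    funext a b; exact propext openGraph_adj
  rw [this]; rfl

/-- The probability that the cluster of a vertex hits a target does not depend on the vertex. -/
lemma percolation_target_le (htrans : G.IsTransitiveUnderIsometries) (q : unitInterval)
    (o v : G.verts) (w : HypSpace d) (ε : ℝ) : ∃ w' : HypSpace d,
    G.percolation q {ω | ∃ y : G.verts, (y : HypSpace d) ∈ target (v : HypSpace d) w ε ∧
      Conn (G.edgeEmb '' ω) v y} ≤
    G.percolation q {ω | ∃ y : G.verts, (y : HypSpace d) ∈ target (o : HypSpace d) w' ε ∧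
      Conn (G.edgeEmb '' ω) o y} := by
  obtain ⟨φ, σ, hi, hσ, ho⟩ := exists_isom htrans o v
  refine ⟨φ.symm w, ?_⟩
  conv_rhs => rw [percolation, ← setBernoulli_preimage_perm q σ.mapEdgeSet]
  refine measure_mono ?_
  rintro ω ⟨y, hy, hc⟩
  refine ⟨σ.symm y, ?_, ?_⟩
  · rw [← hi.mem_target_iff, ← hσ, ← hσ, ho, RelIso.apply_symm_apply, Equiv.apply_symm_apply]
    exact hy
  · have ho' : o = σ.symm v := by rw [← ho, RelIso.symm_apply_apply]
    rw [ho']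
    refine Relation.ReflTransGen.lift σ.symm ?_ _ _ hc
    rintro a b ⟨e, he, hab⟩
    refine ⟨σ.symm.mapEdgeSet e, ?_, ?_⟩
    · change σ.mapEdgeSet (σ.mapEdgeSet.symm e) ∈ ω
      rwa [Equiv.apply_symm_apply]
    · have h1 : (e : Sym2 G.verts) = s(a, b) := hab
      change (e : Sym2 G.verts).map σ.symm = _
      rw [h1]; rfl

/-- Otherwise there are targets with `ε → 0`, each hit with probability at least `η`, whose
directions converge along a subsequence to some `ξ`. Then the cluster of `o` comes arbitrarily close
to `ξ` with probability at least `η`, by continuity from above, which contradicts `q` being a null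
parameter. -/
lemma exists_target_small (hfin : G.IsLocallyFinite) (o : G.verts) {q : unitInterval}
    (hq : q ∈ G.nullParameters o) {η : ENNReal} (hη : 0 < η) : ∃ ε > 0, ∀ w : HypSpace d,
    G.percolation q {ω | ∃ y : G.verts, (y : HypSpace d) ∈ target (o : HypSpace d) w ε ∧
      Conn (G.edgeEmb '' ω) o y} < η := by
  have := countable_verts hfin
  by_contra hn
  push Not at hn
  choose w hw using fun n : ℕ => hn (1 / ((n : ℝ) + 1)) (by positivity)
  obtain ⟨ξ, hξ, ψ, hψ, hlim⟩ := (isCompact_closedBall (0 : EuclideanSpace ℝ (Fin d)) 1).tendsto_subseq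
    (x := fun n => (w n : EuclideanSpace ℝ (Fin d)))
    (fun n => Metric.ball_subset_closedBall (w n).2)
  set c := 25 / ht (o : HypSpace d) ^ 2 with hc
  have hc0 : 0 ≤ c := by positivity
  have hεlim : Tendsto (fun n => c * (1 / ((ψ n : ℝ) + 1))) atTop (𝓝 0) := by
    have h1 := (tendsto_one_div_add_atTop_nhds_zero_nat (𝕜 := ℝ)).comp hψ.tendsto_atTop
    simpa using h1.const_mul c
  have hclose : ∀ n (x : HypSpace d), x ∈ target (o : HypSpace d) (w (ψ n)) (1 / ((ψ n : ℝ) + 1)) →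
      ‖(x : EuclideanSpace ℝ (Fin d)) - w (ψ n)‖ ^ 2 ≤ c * (1 / ((ψ n : ℝ) + 1)) ∧
      ht x ≤ c * (1 / ((ψ n : ℝ) + 1)) := fun n x hx =>
    norm_sub_le_of_mem_target (by positivity) hx
  have hnear : ∀ r > 0, ∀ᶠ n in atTop, ∀ x : HypSpace d,
      x ∈ target (o : HypSpace d) (w (ψ n)) (1 / ((ψ n : ℝ) + 1)) →
      ‖(x : EuclideanSpace ℝ (Fin d)) - ξ‖ < r ∧ ht x < r := by
    intro r hr
    have h1 : ∀ᶠ n in atTop, dist (w (ψ n) : EuclideanSpace ℝ (Fin d)) ξ < r / 2 :=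
      (Metric.tendsto_nhds.1 hlim) (r / 2) (by positivity)
    have h2 := hεlim.eventually_lt_const (show 0 < min r ((r / 2) ^ 2) by positivity)
    filter_upwards [h1, h2] with n h1 h2 x hx
    obtain ⟨h3, h4⟩ := hclose n x hx
    have h5 : ‖(x : EuclideanSpace ℝ (Fin d)) - w (ψ n)‖ < r / 2 :=
      lt_of_pow_lt_pow_left₀ 2 (by positivity) (h3.trans_lt (h2.trans_le (min_le_right _ _)))
    refine ⟨?_, h4.trans_lt (h2.trans_le (min_le_left _ _))⟩
    have h6 := norm_sub_le_norm_sub_add_norm_sub (x : EuclideanSpace ℝ (Fin d)) (w (ψ n)) ξ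
    rw [dist_eq_norm] at h1
    linarith
  have hne : ∀ n, ∃ x : HypSpace d, x ∈ target (o : HypSpace d) (w n) (1 / ((n : ℝ) + 1)) := by
    intro n
    have h1 := nonempty_of_measure_ne_zero (hη.trans_le (hw n)).ne'
    obtain ⟨ω, y, hy, _⟩ := h1
    exact ⟨y, hy⟩
  -- The targets are nonempty; if `ξ` were inside the ball, their points would be near `ξ` and yet
  -- have height near `0`.
  have hξ1 : ‖ξ‖ = 1 := by
    refine le_antisymm (by simpa using hξ) ?_
    by_contra hlt
    push Not at hlt
    set r := (1 - ‖ξ‖) / 4 with hr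
    have hr0 : 0 < r := by linarith
    obtain ⟨n, hn⟩ := (hnear r hr0).exists
    obtain ⟨x, hx⟩ := hne (ψ n)
    obtain ⟨h1, h2⟩ := hn x hx
    have h3 := norm_sub_norm_le (x : EuclideanSpace ℝ (Fin d)) ξ
    have h4 := norm_lt_one x
    have h5 := norm_nonneg (x : EuclideanSpace ℝ (Fin d))
    unfold ht at h2
    nlinarith
  let A : ℕ → Set (Set G.graph.edgeSet) := fun k => {ω | ∃ y : G.verts,
    ‖((y : HypSpace d) : EuclideanSpace ℝ (Fin d)) - ξ‖ < 1 / ((k : ℝ) + 1) ∧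
      Conn (G.edgeEmb '' ω) o y}
  have hAη : ∀ k, η ≤ G.percolation q (A k) := by
    intro k
    obtain ⟨n, hn⟩ := (hnear (1 / ((k : ℝ) + 1)) (by positivity)).exists
    refine (hw (ψ n)).trans (measure_mono ?_)
    rintro ω ⟨y, hy, hc⟩
    exact ⟨y, (hn y hy).1, hc⟩
  have hAm : ∀ k, MeasurableSet (A k) := by
    intro k
    have : A k = ⋃ y ∈ {y : G.verts |
        ‖((y : HypSpace d) : EuclideanSpace ℝ (Fin d)) - ξ‖ < 1 / ((k : ℝ) + 1)},
        {ω | Conn (G.edgeEmb '' ω) o y} := by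
      ext ω; simp [A]
    rw [this]
    exact MeasurableSet.biUnion (Set.to_countable _) fun y _ => measurableSet_conn _ _ _
  have hAanti : Antitone A := by
    rintro k l hkl ω ⟨y, hy, hc⟩
    refine ⟨y, hy.trans_le ?_, hc⟩
    gcongr
  have : IsProbabilityMeasure (G.percolation q) := by unfold percolation; infer_instance
  have hinter : η ≤ G.percolation q (⋂ k, A k) := by
    rw [hAanti.measure_iInter (fun k => (hAm k).nullMeasurableSet) ⟨0, measure_ne_top _ _⟩]
    exact le_iInf hAη
  have hnull := hq ⟨ξ, by simpa using hξ1⟩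
  refine absurd (hinter.trans (measure_mono (fun ω hω => ?_))) (not_le.2 (hnull.trans_lt hη))
  refine ⟨Metric.mem_closure_iff.2 fun r hr => ?_, by simp [hξ1]⟩
  obtain ⟨k, hk⟩ := exists_nat_one_div_lt hr
  obtain ⟨y, hy, hc⟩ := Set.mem_iInter.1 hω k
  refine ⟨_, ⟨y, ⟨y, reachable_iff_conn.2 hc, Or.inl rfl⟩, rfl⟩, ?_⟩
  rw [dist_comm, dist_eq_norm]
  exact hy.trans hk

end HypGraph

/-! ### Crossings near the sphere at infinity -/

open HypSpace in
/-- A separated set of points of the ball at distance at least `t` from the sphere has at most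
polynomially many points in `1 / t`. -/
lemma card_le_of_forall_le_sep {d : ℕ} {r t : ℝ} (hr : 0 < r) (ht0 : 0 < t)
    (F : Finset (HypSpace d)) (hF : ∀ x ∈ F, t ≤ ht x)
    (hsep : ∀ x ∈ F, ∀ y ∈ F, x ≠ y → r ≤ sep x y) :
    (F.card : ℝ) ≤ (2 / (t * √(r / (d + 1))) + 2) ^ d := by
  classical
  -- The side of the grid cells: two points in one cell satisfy `‖x - y‖ ^ 2 ≤ d * a ^ 2 < r * t ^
  -- 2`, which separation forbids. So each cell holds at most one point, and cells are counted.
  set a := t * √(r / (d + 1)) with ha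
  have ha0 : 0 < a := by positivity
  let g : HypSpace d → Fin d → ℤ := fun x i => ⌊(x : EuclideanSpace ℝ (Fin d)) i / a⌋
  have hinj : Set.InjOn g F := by
    intro x hx y hy hxy
    by_contra hne
    have h1 := hsep x hx y hy hne
    have h2 := norm_sub_sq_eq x y
    have h3 : ‖(x : EuclideanSpace ℝ (Fin d)) - y‖ ^ 2 ≤ d * a ^ 2 := by
      rw [EuclideanSpace.norm_sq_eq]
      calc ∑ i, ‖((x : EuclideanSpace ℝ (Fin d)) - y) i‖ ^ 2 ≤ ∑ _i : Fin d, a ^ 2 := by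
            refine Finset.sum_le_sum fun i _ => ?_
            have h4 := Int.abs_sub_lt_one_of_floor_eq_floor (congrFun hxy i)
            rw [← sub_div, abs_div, abs_of_pos ha0, div_lt_one ha0] at h4
            rw [Real.norm_eq_abs]
            exact pow_le_pow_left₀ (abs_nonneg _) h4.le 2
        _ = d * a ^ 2 := by simp
    have h5 : t * t ≤ ht x * ht y :=
      mul_le_mul (hF x hx) (hF y hy) ht0.le (ht_pos x).le
    have h6 : r * (t * t) ≤ sep x y * (ht x * ht y) :=
      mul_le_mul h1 h5 (by positivity) (sep_nonneg x y)
    have h7 : a ^ 2 = t * t * (r / (d + 1)) := by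
      rw [ha, mul_pow, Real.sq_sqrt (by positivity)]; ring
    have h8 : d * a ^ 2 < r * (t * t) := by
      rw [h7]
      have : (d : ℝ) * (t * t * (r / (d + 1))) = r * (t * t) * (d / (d + 1)) := by ring
      rw [this]
      refine mul_lt_of_lt_one_right (by positivity) ?_
      rw [div_lt_one (by positivity)]
      linarith
    linarith
  have hmaps : Set.MapsTo g F (Fintype.piFinset fun _ : Fin d => Finset.Icc ⌊-1 / a⌋ ⌊1 / a⌋) := by
    intro x _
    simp only [Finset.mem_coe, Fintype.mem_piFinset, Finset.mem_Icc]
    intro i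
    have h1 : |(x : EuclideanSpace ℝ (Fin d)) i| ≤ 1 :=
      (PiLp.norm_apply_le (x : EuclideanSpace ℝ (Fin d)) i).trans (norm_lt_one x).le
    rw [abs_le] at h1
    exact ⟨Int.floor_le_floor (by gcongr; exact h1.1), Int.floor_le_floor (by gcongr; exact h1.2)⟩
  have hcard := Finset.card_le_card_of_injOn g hmaps hinj
  rw [Fintype.card_piFinset, Finset.prod_const, Finset.card_univ, Fintype.card_fin,
    Int.card_Icc] at hcard
  have h9 : ((⌊1 / a⌋ + 1 - ⌊-1 / a⌋).toNat : ℝ) ≤ 2 / a + 2 := by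
    have h10 : ⌊-1 / a⌋ ≤ ⌊1 / a⌋ := Int.floor_le_floor (by gcongr; norm_num)
    have h11 : 0 ≤ ⌊1 / a⌋ + 1 - ⌊-1 / a⌋ := by linarith
    rw [← Int.cast_natCast, Int.toNat_of_nonneg h11]
    push_cast
    have h12 := Int.floor_le (1 / a)
    have h13 := Int.lt_floor_add_one (-1 / a)
    have h14 : -1 / a = -(1 / a) := by ring
    have h15 : 2 / a = 1 / a + 1 / a := by ring
    linarith
  calc (F.card : ℝ) ≤ (((⌊1 / a⌋ + 1 - ⌊-1 / a⌋).toNat ^ d : ℕ) : ℝ) := by exact_mod_cast hcard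
    _ ≤ _ := by
      push_cast
      exact pow_le_pow_left₀ (by positivity) h9 d

namespace HypGraph

open HypSpace Filter Topology

variable {d : ℕ} (G : HypGraph d)

/-- The vertices at height at most `h`. -/
def slab (h : ℝ) : Set G.verts := {x | ht (x : HypSpace d) ≤ h}

variable {G}

/-- The constant `B` serves all `h`: dividing Euclidean distance by `h` makes both the edge lengths
and the unlikely radius `n` bounded independently of the slab. -/
lemma exists_slab_decay (hfin : G.IsLocallyFinite) (htrans : G.IsTransitiveUnderIsometries)
    (o : G.verts) {p : unitInterval} (hp : (p : ℝ) < G.pZero o) : ∃ B > 0, ∀ h > 0, ∀ k : ℕ,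
    ∀ v ∈ G.slab h, G.percolation p {ω | ∃ y : G.verts,
      k * (B * h) ≤ ‖((v : HypSpace d) : EuclideanSpace ℝ (Fin d)) - (y : HypSpace d)‖ ∧
        Conn (G.edgeEmb '' ω ∩ inside (G.slab h)) v y} ≤ ENNReal.ofReal ((1 / 2) ^ k) := by
  have := countable_verts hfin
  -- If there were no null parameter, `pZero` would be the default `sSup ∅ = 0`, which excludes `p <
  -- pZero`.
  have hne : ((fun p : unitInterval => (p : ℝ)) '' G.nullParameters o).Nonempty := by
    by_contra hem
    rw [Set.not_nonempty_iff_eq_empty] at hem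
    rw [pZero, hem, Real.sSup_empty] at hp
    exact absurd p.2.1 (not_le.2 hp)
  obtain ⟨_, ⟨q, hq, rfl⟩, hpq⟩ := exists_lt_of_lt_csSup hne hp
  have hpq' : (p : ℝ) < q := hpq
  obtain ⟨ε, hε, hsmall⟩ := exists_target_small hfin o hq
    (η := ENNReal.ofReal ((q - p) / 4)) (by rw [ENNReal.ofReal_pos]; linarith)
  obtain ⟨S, hS0, hS⟩ := exists_forall_adj_sep_le hfin htrans o
  set n := 1 / √ε with hn
  have hn0 : 0 < n := by positivity
  have hnε : 1 / n ^ 2 = ε := by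
    rw [hn, div_pow, Real.sq_sqrt hε.le]; field_simp
  -- The term `√S` bounds the rescaled length of slab edges, because `‖x - y‖ ^ 2 = sep x y * (ht x
  -- * ht y) ≤ S * h ^ 2`.
  refine ⟨n + √S, by positivity, fun h hh k v hv => ?_⟩
  have key := setBernoulli_radius_le (p := p) (q := q) hpq G.edgeEmb (inside (G.slab h))
    (G.slab h) subset_rfl hn0 (Real.sqrt_nonneg S)
    (fun x y => ‖((x : HypSpace d) : EuclideanSpace ℝ (Fin d)) - (y : HypSpace d)‖ / h)
    (fun x y z => by
      rw [← add_div]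
      gcongr
      exact norm_sub_le_norm_sub_add_norm_sub _ _ _)
    (fun i x y hi hxy => by
      have hx : ht (x : HypSpace d) ≤ h := (mk_mem_inside.1 hxy).1
      have hy : ht (y : HypSpace d) ≤ h := (mk_mem_inside.1 hxy).2
      have hadj : G.graph.Adj x y := G.graph.mem_edgeSet.1 (hi ▸ i.2)
      rw [div_le_iff₀ hh]
      refine le_of_sq_le_sq ?_ (by positivity)
      rw [mul_pow, Real.sq_sqrt hS0, norm_sub_sq_eq, sq h]
      exact mul_le_mul (hS x y hadj) (mul_le_mul hx hy (ht_pos _).le hh.le)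
        (mul_pos (ht_pos _) (ht_pos _)).le hS0)
    (fun x hx => by
      obtain ⟨w', hw'⟩ := percolation_target_le htrans q o x origin ε
      refine lt_of_le_of_lt (le_trans (measure_mono ?_) hw') (hsmall w')
      rintro ω ⟨y, hy, hxy, hc⟩
      refine ⟨y, ?_, hc⟩
      rw [← hnε]
      rw [le_div_iff₀ hh, norm_sub_rev] at hxy
      exact mem_target_origin hn0 hh hy hx hxy) k v hv
  refine le_trans (measure_mono ?_) key
  rintro ω ⟨y, hy, hc⟩
  refine ⟨y, ?_, hc⟩
  rw [le_div_iff₀ hh, mul_assoc]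
  exact hy

variable (G) in
/-- The configurations in which some vertex at height comparable to `h` is joined to Euclidean
distance `δ` below height `h`. -/
def crossing (c δ h : ℝ) : Set (Set G.graph.edgeSet) :=
  {ω | ∃ x ∈ G.slab h, h ≤ c * ht (x : HypSpace d) ∧ ∃ y : G.verts,
    δ ≤ ‖((x : HypSpace d) : EuclideanSpace ℝ (Fin d)) - (y : HypSpace d)‖ ∧
      Conn (G.edgeEmb '' ω ∩ inside (G.slab h)) x y}

/-- A union bound over the vertices of height comparable to `h`: polynomial growth in `1 / h` loses
against decay exponential in `δ / h`. Crossing along a whole tail of a sequence of heights is then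
null, having probability below every term of a null sequence. -/
lemma ae_not_eventually_crossing (hfin : G.IsLocallyFinite)
    (htrans : G.IsTransitiveUnderIsometries)
    (o : G.verts) {p : unitInterval} (hp : (p : ℝ) < G.pZero o) {c δ : ℝ} (hc : 0 < c)
    (hδ : 0 < δ) :
    ∀ᵐ ω ∂G.percolation p, ¬ ∃ h₀ > 0, ∀ h, 0 < h → h < h₀ → ω ∈ G.crossing c δ h := by
  classical
  obtain ⟨B, hB, hdecay⟩ := exists_slab_decay hfin htrans o hp
  obtain ⟨r, hr, hsep⟩ := exists_forall_ne_le_sep hfin htrans o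
  -- Chosen so that `δ = (m + 1) * (B * H m)`: a crossing at height `H m` makes exactly `m + 1`
  -- steps of `exists_slab_decay`.
  let H : ℕ → ℝ := fun m => δ / (B * ((m : ℝ) + 1))
  have hH : ∀ m, 0 < H m := fun m => by positivity
  set A := 2 * c * B / (δ * √(r / (d + 1))) with hA
  have hA0 : 0 ≤ A := by positivity
  have hbound : ∀ m, G.percolation p (G.crossing c δ (H m)) ≤
      ENNReal.ofReal ((A + 2) ^ d * (((m + 1 : ℕ) : ℝ) ^ d * (1 / 2) ^ (m + 1))) := by
    intro m
    have ht0 : 0 < H m / c := div_pos (hH m) hc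
    obtain ⟨F, hF⟩ := (hfin _ (isCompact_le_ht ht0)).1.exists_finset_coe
    have hFm : ∀ x, x ∈ F ↔ x ∈ G.verts ∧ H m / c ≤ ht x := by
      intro x
      rw [← Finset.mem_coe, hF]; rfl
    have hcard : (F.card : ℝ) ≤ (A + 2) ^ d * ((m + 1 : ℕ) : ℝ) ^ d := by
      refine (card_le_of_forall_le_sep hr ht0 F (fun x hx => ((hFm x).1 hx).2)
        fun x hx y hy hne => ?_).trans ?_
      · exact hsep ⟨x, ((hFm x).1 hx).1⟩ ⟨y, ((hFm y).1 hy).1⟩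
          fun h => hne (congrArg Subtype.val h)
      · rw [← mul_pow]
        refine pow_le_pow_left₀ (by positivity) ?_ d
        have h1 : 2 / (H m / c * √(r / (d + 1))) = A * ((m + 1 : ℕ) : ℝ) := by
          simp only [H, hA]; push_cast; field_simp
        have h2 : (1 : ℝ) ≤ ((m + 1 : ℕ) : ℝ) := by push_cast; linarith [Nat.cast_nonneg (α := ℝ) m]
        rw [h1]; linarith
    let T : HypSpace d → Set (Set G.graph.edgeSet) := fun x => {ω | ∃ x' ∈ G.slab (H m),
      (x' : HypSpace d) = x ∧ ∃ y : G.verts, ((m + 1 : ℕ) : ℝ) * (B * H m) ≤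
        ‖((x' : HypSpace d) : EuclideanSpace ℝ (Fin d)) - (y : HypSpace d)‖ ∧
      Conn (G.edgeEmb '' ω ∩ inside (G.slab (H m))) x' y}
    have hT : ∀ x, G.percolation p (T x) ≤ ENNReal.ofReal ((1 / 2) ^ (m + 1)) := by
      intro x
      by_cases hx : ∃ x' ∈ G.slab (H m), (x' : HypSpace d) = x
      · obtain ⟨x', hx', rfl⟩ := hx
        refine (measure_mono ?_).trans (hdecay (H m) (hH m) (m + 1) x' hx')
        rintro ω ⟨x'', _, he, y, hy⟩
        obtain rfl : x'' = x' := Subtype.ext he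
        exact ⟨y, hy⟩
      · have : T x = ∅ := by
          refine Set.eq_empty_of_forall_notMem fun ω => ?_
          rintro ⟨x', hx', he, _⟩
          exact hx ⟨x', hx', he⟩
        simp [this]
    have hsub : G.crossing c δ (H m) ⊆ ⋃ x ∈ F, T x := by
      rintro ω ⟨x, hx, hcx, y, hy, hc'⟩
      simp only [Set.mem_iUnion]
      refine ⟨x, (hFm x).2 ⟨x.2, ?_⟩, x, hx, rfl, y, ?_, hc'⟩
      · rw [div_le_iff₀ hc]; linarith
      · refine le_trans (le_of_eq ?_) hy
        simp only [H]; push_cast; field_simp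
    calc G.percolation p (G.crossing c δ (H m)) ≤ ∑ x ∈ F, G.percolation p (T x) :=
          (measure_mono hsub).trans (measure_biUnion_finset_le _ _)
      _ ≤ ∑ _x ∈ F, ENNReal.ofReal ((1 / 2) ^ (m + 1)) := Finset.sum_le_sum fun x _ => hT x
      _ = ENNReal.ofReal (F.card * (1 / 2) ^ (m + 1)) := by
          rw [Finset.sum_const, nsmul_eq_mul, ENNReal.ofReal_mul (by positivity),
            ENNReal.ofReal_natCast]
      _ ≤ _ := by
          refine ENNReal.ofReal_le_ofReal ?_
          rw [← mul_assoc]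
          gcongr
  have hlim : Tendsto (fun m : ℕ =>
      ENNReal.ofReal ((A + 2) ^ d * (((m + 1 : ℕ) : ℝ) ^ d * (1 / 2) ^ (m + 1)))) atTop (𝓝 0) := by
    have h1 : Tendsto (fun m : ℕ => (m : ℝ) ^ d * (1 / 2 : ℝ) ^ m) atTop (𝓝 0) :=
      tendsto_pow_const_mul_const_pow_of_abs_lt_one d (by norm_num [abs_lt])
    have h2 := ((tendsto_add_atTop_iff_nat 1).2 h1).const_mul ((A + 2) ^ d)
    rw [mul_zero] at h2
    simpa using ENNReal.tendsto_ofReal h2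
  have hnull : ∀ N, G.percolation p (⋂ m ≥ N, G.crossing c δ (H m)) = 0 := by
    intro N
    refine le_antisymm (ge_of_tendsto hlim ?_) zero_le
    filter_upwards [eventually_ge_atTop N] with m hm
    exact (measure_mono (Set.biInter_subset_of_mem hm)).trans (hbound m)
  have hHlim : Tendsto H atTop (𝓝 0) := by
    have h1 := (tendsto_one_div_add_atTop_nhds_zero_nat (𝕜 := ℝ)).const_mul (δ / B)
    rw [mul_zero] at h1
    refine h1.congr fun m => ?_
    simp only [H]; field_simp
  rw [ae_iff]
  refine measure_mono_null ?_ (measure_iUnion_null hnull)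
  intro ω hω
  simp only [Set.mem_ofPred_eq, not_not] at hω
  obtain ⟨h₀, hh₀, hω⟩ := hω
  obtain ⟨N, hN⟩ := eventually_atTop.1 (hHlim.eventually_lt_const hh₀)
  simp only [Set.mem_iUnion, Set.mem_iInter]
  exact ⟨N, fun m hm => hω (H m) (hH m) (hN m hm)⟩

end HypGraph

/-! ### Ends of clusters -/

namespace HypGraph

open HypSpace Filter Topology

variable {d : ℕ} (G : HypGraph d)

/-- The union of the vertices in `D` and the edges in `R` at these vertices. -/
def star (R : Set (Sym2 G.verts)) (D : Set G.verts) : Set (HypSpace d) :=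
  {z | ∃ w ∈ D, z = w ∨ ∃ w', s(w, w') ∈ R ∧ z ∈ segment (w : HypSpace d) w'}

variable {G}

/-- Here the embedding is used: edges meet only at common endpoints and contain no other vertices,
so pieces that touch geometrically are joined combinatorially. -/
lemma disjoint_star {R : Set (Sym2 G.verts)} (hR : R ⊆ G.graph.edgeSet) {D D' : Set G.verts}
    (hDD' : Disjoint D D') (hD : ∀ a ∈ D, ∀ b, s(a, b) ∈ R → b ∈ D)
    (hD' : ∀ a ∈ D', ∀ b, s(a, b) ∈ R → b ∈ D') : Disjoint (G.star R D) (G.star R D') := by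
  have hne : ∀ {a b : G.verts}, a ∈ D → b ∈ D' → (a : HypSpace d) ≠ b := fun ha hb h =>
    Set.disjoint_left.1 hDD' ha (Subtype.ext h ▸ hb)
  rw [Set.disjoint_left]
  rintro z ⟨w, hw, hz⟩ ⟨a, ha, hz'⟩
  rcases hz with rfl | ⟨w', hww', hz⟩
  · rcases hz' with h | ⟨a', haa', hz'⟩
    · exact hne hw ha h
    · rcases G.vertex_on_edge a a' w (hR haa') hz' with h | h
      · exact Set.disjoint_left.1 hDD' hw (h ▸ ha)
      · exact Set.disjoint_left.1 hDD' hw (h ▸ hD' a ha a' haa')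
  · have hw' := hD w hw w' hww'
    rcases hz' with rfl | ⟨a', haa', hz'⟩
    · rcases G.vertex_on_edge w w' a (hR hww') hz with h | h
      · exact Set.disjoint_left.1 hDD' hw (h ▸ ha)
      · exact Set.disjoint_left.1 hDD' hw' (h ▸ ha)
    · have ha' := hD' a ha a' haa'
      by_cases heq : s(w, w') = s(a, a')
      · rcases Sym2.eq_iff.1 heq with ⟨rfl, _⟩ | ⟨rfl, _⟩
        · exact hne hw ha rfl
        · exact hne hw ha' rfl
      · obtain ⟨h1, h2⟩ := G.edge_inter_edge w w' a a' (hR hww') (hR haa') heq z ⟨hz, hz'⟩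
        rcases h1 with h1 | h1 <;> rcases h2 with h2 | h2
        · exact hne hw ha (h1.symm.trans h2)
        · exact hne hw ha' (h1.symm.trans h2)
        · exact hne hw' ha (h1.symm.trans h2)
        · exact hne hw' ha' (h1.symm.trans h2)

lemma exists_compact_nhds (x : HypSpace d) : ∃ K ∈ 𝓝 x, IsCompact K :=
  ⟨{y | ht x / 2 ≤ ht y},
    continuous_ht.continuousAt.eventually_const_le (half_lt_self (ht_pos _)),
    isCompact_le_ht (half_pos (ht_pos x))⟩

/-- Local finiteness keeps an infinite union of points and segments closed, so that connectedness
can be tested against two closed pieces. -/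
lemma isClosed_star (hfin : G.IsLocallyFinite) {R : Set (Sym2 G.verts)} (hR : R ⊆ G.graph.edgeSet)
    (D : Set G.verts) : IsClosed (G.star R D) := by
  let T : Set (Sym2 G.verts) := {e ∈ R | ∃ w ∈ D, w ∈ e}
  have h : G.star R D = (⋃ w : D, {((w : G.verts) : HypSpace d)}) ∪ ⋃ e : T, G.edgeSegment e := by
    ext z
    simp only [star, Set.mem_ofPred_eq, Set.mem_union, Set.mem_iUnion, Set.mem_singleton_iff]
    constructor
    · rintro ⟨w, hw, rfl | ⟨w', hww', hz⟩⟩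
      · exact Or.inl ⟨⟨w, hw⟩, rfl⟩
      · exact Or.inr ⟨⟨s(w, w'), hww', w, hw, by simp⟩, mem_edgeSegment.2 hz⟩
    · rintro (⟨w, rfl⟩ | ⟨⟨e, he, w, hw, hwe⟩, hz⟩)
      · exact ⟨w, w.2, Or.inl rfl⟩
      · obtain ⟨w', rfl⟩ := Sym2.mem_iff_exists.1 hwe
        exact ⟨w, hw, Or.inr ⟨w', he, mem_edgeSegment.1 hz⟩⟩
  rw [h]
  refine IsClosed.union (LocallyFinite.isClosed_iUnion ?_ fun w => isClosed_singleton)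
    (LocallyFinite.isClosed_iUnion ?_ ?_)
  · intro x
    obtain ⟨K, hKx, hK⟩ := exists_compact_nhds x
    refine ⟨K, hKx, ?_⟩
    refine Set.Finite.of_finite_image (f := fun w : D => ((w : G.verts) : HypSpace d))
      ((hfin K hK).1.subset ?_) (Subtype.val_injective.comp Subtype.val_injective).injOn
    rintro _ ⟨w, ⟨y, hy, hyK⟩, rfl⟩
    rw [Set.mem_singleton_iff] at hy
    subst hy
    exact ⟨w.1.2, hyK⟩
  · intro x
    obtain ⟨K, hKx, hK⟩ := exists_compact_nhds x
    refine ⟨K, hKx, ?_⟩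
    refine Set.Finite.of_finite_image (f := fun e : T => (e : Sym2 G.verts))
      ((hfin K hK).2.subset ?_) Subtype.val_injective.injOn
    rintro _ ⟨e, he, rfl⟩
    exact ⟨hR e.2.1, he⟩
  · rintro ⟨e, he⟩
    induction e using Sym2.ind with
    | _ u v =>
      have : G.edgeSegment s(u, v) = segment (u : HypSpace d) v := by
        ext z; exact mem_edgeSegment
      change IsClosed (G.edgeSegment s(u, v))
      rw [this]
      exact HypSpace.isClosed_segment _ _

/-- A preconnected subset of a union of edges lies in the edges of one component. -/
lemma subset_star_component (hfin : G.IsLocallyFinite) {R : Set (Sym2 G.verts)}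
    (hR : R ⊆ G.graph.edgeSet) {X : Set (HypSpace d)} (hX : IsPreconnected X)
    (hXR : X ⊆ G.star R Set.univ) {w₀ : G.verts} (hw₀ : (X ∩ G.star R {w₀}).Nonempty) :
    X ⊆ G.star R {w | Conn R w₀ w} := by
  set D := {w | Conn R w₀ w} with hDdef
  have hD : ∀ a ∈ D, ∀ b, s(a, b) ∈ R → b ∈ D := fun a ha b hab =>
    Conn.trans ha (Conn.single hab)
  have hDc : ∀ a ∈ Dᶜ, ∀ b, s(a, b) ∈ R → b ∈ Dᶜ := fun a ha b hab hb =>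
    ha (hD b hb a (by rwa [Sym2.eq_swap]))
  have hdisj := disjoint_star hR disjoint_compl_right hD hDc
  have hcov : X ⊆ G.star R D ∪ G.star R Dᶜ := by
    intro z hz
    obtain ⟨w, _, hw⟩ := hXR hz
    by_cases hwD : w ∈ D
    · exact Or.inl ⟨w, hwD, hw⟩
    · exact Or.inr ⟨w, hwD, hw⟩
  rcases isPreconnected_iff_subset_of_disjoint_closed.1 hX _ _ (isClosed_star hfin hR D)
    (isClosed_star hfin hR Dᶜ) hcov (by rw [hdisj.inter_eq, Set.inter_empty]) with h | h
  · exact h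
  · obtain ⟨z, hzX, w, rfl, hz⟩ := hw₀
    exact absurd (h hzX) (Set.disjoint_left.1 hdisj ⟨w, Conn.refl _ _, hz⟩)

lemma image_edgeEmb_subset (ω : Set G.graph.edgeSet) : G.edgeEmb '' ω ⊆ G.graph.edgeSet := by
  rintro _ ⟨e, _, rfl⟩; exact e.2

/-- An end with two distinct boundary points gives crossings at all small heights. -/
lemma mem_crossing_of_end (hfin : G.IsLocallyFinite) {S : ℝ} (hS0 : 0 ≤ S)
    (hS : ∀ u v : G.verts, G.graph.Adj u v → sep (u : HypSpace d) v ≤ S)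
    {ω : Set G.graph.edgeSet} {v : G.verts} (e : SetEnd (G.cluster ω v))
    {ξ η : EuclideanSpace ℝ (Fin d)} (hξ : ξ ∈ e.boundary) (hη : η ∈ e.boundary) {h : ℝ}
    (hh : 0 < h) (hv : h < ht (v : HypSpace d)) (hsmall : √S * h ≤ ‖ξ - η‖ / 8) (hξη : ξ ≠ η) :
    ω ∈ G.crossing (2 + 4 * S) (‖ξ - η‖ / 4) h := by
  set c := 2 + 4 * S with hc
  have hc0 : 0 < c := by positivity
  have hΔ : 0 < ‖ξ - η‖ := norm_pos_iff.2 (sub_ne_zero.2 hξη)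
  set R := G.edgeEmb '' ω ∩ inside (G.slab h) with hRdef
  have hR : R ⊆ G.graph.edgeSet := Set.inter_subset_left.trans (image_edgeEmb_subset ω)
  -- The factor `c` compares heights along an edge: an edge with a point outside `K` has both
  -- endpoints in the slab of height `h`.
  let K : TopologicalSpace.Compacts (HypSpace d) :=
    ⟨{x | h / c ≤ ht x}, isCompact_le_ht (div_pos hh hc0)⟩
  obtain ⟨z₀, hz₀, hX⟩ := e.isComponent K
  set X := e.toFun K with hXdef
  have hXpre : IsPreconnected X := by rw [hX]; exact isPreconnected_connectedComponentIn
  have hz₀X : z₀ ∈ X := by rw [hX]; exact mem_connectedComponentIn hz₀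
  have hXsub : X ⊆ G.cluster ω v \ K := by rw [hX]; exact connectedComponentIn_subset _ _
  have hlow : ∀ z ∈ X, ht z < h / c := fun z hz => by
    by_contra hlt
    exact (hXsub hz).2 (not_lt.1 hlt)
  have hcz : ∀ z ∈ X, c * ht z ≤ h := fun z hz => by
    have := hlow z hz
    rw [lt_div_iff₀ hc0] at this
    linarith
  have hstar : ∀ z ∈ X, ∃ w : G.verts, w ∈ G.slab h ∧ (G.openGraph ω).Reachable v w ∧
      z ∈ G.star R {w} := by
    intro z hz
    obtain ⟨w, hvw, hzw⟩ := (hXsub hz).1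
    have hz1 := hcz z hz
    rcases hzw with rfl | ⟨w', hadj, hzw⟩
    · refine ⟨w, ?_, hvw, w, rfl, Or.inl rfl⟩
      change ht (w : HypSpace d) ≤ h
      nlinarith [ht_pos (w : HypSpace d)]
    · rw [openGraph_adj] at hadj
      have hadj' := adj_of_mem_image hadj
      have h1 := (sep_le_of_mem_segment hzw).trans (hS w w' hadj')
      have h2 := (sep_le_of_mem_segment (HypSpace.segment_symm (w : HypSpace d) w' ▸ hzw)).trans
        (hS w' w hadj'.symm)
      have hw : w ∈ G.slab h := (ht_le_mul_ht (sep_comm (w : HypSpace d) z ▸ h1)).trans hz1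
      have hw' : w' ∈ G.slab h := (ht_le_mul_ht (sep_comm (w' : HypSpace d) z ▸ h2)).trans hz1
      exact ⟨w, hw, hvw, w, rfl, Or.inr ⟨w', ⟨hadj, mk_mem_inside.2 ⟨hw, hw'⟩⟩, hzw⟩⟩
  obtain ⟨w₀, hw₀, hvw₀, hz₀w₀⟩ := hstar z₀ hz₀X
  have hcomp := subset_star_component hfin hR hXpre
    (fun z hz => by
      obtain ⟨w, _, _, w', _, hw⟩ := hstar z hz
      exact ⟨w', Set.mem_univ _, hw⟩) ⟨z₀, hz₀X, hz₀w₀⟩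
  have hnear : ∀ ζ ∈ e.boundary, ∃ w, Conn R w₀ w ∧
      ‖((w : HypSpace d) : EuclideanSpace ℝ (Fin d)) - ζ‖ < ‖ξ - η‖ / 4 := by
    intro ζ hζ
    have h1 := (Set.mem_iInter.1 hζ K).1
    obtain ⟨_, ⟨z, hz, rfl⟩, hzζ⟩ := Metric.mem_closure_iff.1 h1 (‖ξ - η‖ / 8) (by positivity)
    rw [dist_comm, dist_eq_norm] at hzζ
    obtain ⟨w, hw, hzw⟩ := hcomp hz
    refine ⟨w, hw, ?_⟩
    have h2 : ‖((w : HypSpace d) : EuclideanSpace ℝ (Fin d)) - z‖ ≤ √S * h := by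
      rcases hzw with rfl | ⟨w', hww', hzw⟩
      · simp; positivity
      · refine le_of_sq_le_sq ?_ (by positivity)
        have h3 := (sep_le_of_mem_segment hzw).trans (hS w w' (hR hww'))
        have h4 : ht (w : HypSpace d) ≤ h := (mk_mem_inside.1 hww'.2).1
        have h5 : ht z ≤ h := by nlinarith [hcz z hz, ht_pos z]
        rw [mul_pow, Real.sq_sqrt hS0, norm_sub_sq_eq, sq h]
        exact mul_le_mul h3 (mul_le_mul h4 h5 (ht_pos _).le hh.le)
          (mul_pos (ht_pos _) (ht_pos _)).le hS0
    have h3 := norm_sub_le_norm_sub_add_norm_sub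
      ((w : HypSpace d) : EuclideanSpace ℝ (Fin d)) z ζ
    linarith
  obtain ⟨a, ha, haξ⟩ := hnear ξ hξ
  obtain ⟨b, hb, hbη⟩ := hnear η hη
  -- The vertex `v` lies above the slab, so an open path from `w₀` to `v` leaves the slab component
  -- of `w₀`. It can do so only through a neighbour above height `h`, so the vertex `x` of last exit
  -- has height at least `h / c`.
  have hvD : v ∉ {w | Conn R w₀ w} := by
    intro hvD
    have h1 : v ∈ G.slab h := Conn.mem_of_inside hvD hw₀
    exact absurd h1 (not_le.2 hv)
  obtain ⟨x, hx, y, hy, hxy, _⟩ := (reachable_iff_conn.1 hvw₀).symm.exists_last_exit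
    (C := {w | Conn R w₀ w}) (Conn.refl _ _) hvD
  have hxs : x ∈ G.slab h := Conn.mem_of_inside hx hw₀
  have hys : y ∉ G.slab h := fun hys =>
    hy (Conn.trans hx (Conn.single ⟨hxy, mk_mem_inside.2 ⟨hxs, hys⟩⟩))
  have hyx : h ≤ c * ht (x : HypSpace d) :=
    (not_le.1 hys).le.trans (ht_le_mul_ht (hS x y (adj_of_mem_image hxy)))
  -- Since `a` and `b` are within a quarter of `‖ξ - η‖` from `ξ` and `η`, the point `x` cannot be
  -- that close to both.
  have hfar : ‖ξ - η‖ / 4 ≤ ‖((x : HypSpace d) : EuclideanSpace ℝ (Fin d)) - (a : HypSpace d)‖ ∨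
      ‖ξ - η‖ / 4 ≤ ‖((x : HypSpace d) : EuclideanSpace ℝ (Fin d)) - (b : HypSpace d)‖ := by
    by_contra! hlt
    have h1 := norm_sub_le_norm_sub_add_norm_sub ξ ((a : HypSpace d) : EuclideanSpace ℝ (Fin d)) η
    have h2 := norm_sub_le_norm_sub_add_norm_sub
      ((a : HypSpace d) : EuclideanSpace ℝ (Fin d)) (x : HypSpace d) η
    have h3 := norm_sub_le_norm_sub_add_norm_sub
      ((x : HypSpace d) : EuclideanSpace ℝ (Fin d)) (b : HypSpace d) η
    rw [norm_sub_rev ξ (a : HypSpace d)] at h1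
    rw [norm_sub_rev ((a : HypSpace d) : EuclideanSpace ℝ (Fin d)) (x : HypSpace d)] at h2
    linarith [hlt.1, hlt.2]
  rcases hfar with h1 | h1
  · exact ⟨x, hxs, hyx, a, h1, (Conn.symm hx).trans ha⟩
  · exact ⟨x, hxs, hyx, b, h1, (Conn.symm hx).trans hb⟩

/-- Cantor's intersection theorem for the closures of `e(K n)` along an exhaustion by compact sets.
A common point inside the ball would lie in the interior of some `K n`, which `e(K n)` avoids; and
each compact set lies in some `K n`. -/
lemma SetEnd.boundary_nonempty {C : Set (HypSpace d)} (e : SetEnd C) : e.boundary.Nonempty := by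
  let K : ℕ → TopologicalSpace.Compacts (HypSpace d) := fun n =>
    ⟨{x | 1 / ((n : ℝ) + 1) ≤ ht x}, isCompact_le_ht (by positivity)⟩
  have hK : ∀ m n, m ≤ n → (K m : Set (HypSpace d)) ⊆ K n := by
    intro m n hmn x hx
    have h1 : 1 / ((m : ℝ) + 1) ≤ ht x := hx
    refine le_trans ?_ h1
    gcongr
  have hsub : ∀ L, e.toFun L ⊆ C \ (L : Set (HypSpace d)) := by
    intro L
    obtain ⟨x, _, hL⟩ := e.isComponent L
    rw [hL]; exact connectedComponentIn_subset _ _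
  have hball : ∀ L, closure ((fun x : HypSpace d => (x : EuclideanSpace ℝ (Fin d))) '' e.toFun L) ⊆
      Metric.closedBall 0 1 := by
    intro L
    refine closure_minimal ?_ Metric.isClosed_closedBall
    rintro _ ⟨x, _, rfl⟩
    exact Metric.ball_subset_closedBall x.2
  obtain ⟨ξ, hξ⟩ := IsCompact.nonempty_iInter_of_sequence_nonempty_isCompact_isClosed
    (fun n => closure ((fun x : HypSpace d => (x : EuclideanSpace ℝ (Fin d))) '' e.toFun (K n)))
    (fun n => closure_mono (Set.image_mono (e.antitone _ _ (hK n (n + 1) n.le_succ))))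
    (fun n => by
      obtain ⟨x, hx, hL⟩ := e.isComponent (K n)
      refine (Set.Nonempty.image _ ⟨x, ?_⟩).closure
      rw [hL]; exact mem_connectedComponentIn hx)
    ((isCompact_closedBall 0 1).of_isClosed_subset isClosed_closure (hball _))
    (fun n => isClosed_closure)
  have hξ' := Set.mem_iInter.1 hξ
  have hξb : ξ ∉ Metric.ball (0 : EuclideanSpace ℝ (Fin d)) 1 := by
    intro hb
    obtain ⟨n, hn⟩ := exists_nat_one_div_lt (ht_pos ⟨ξ, hb⟩)
    have hopen : IsOpen {y : EuclideanSpace ℝ (Fin d) | 1 / ((n : ℝ) + 1) < 1 - ‖y‖ ^ 2} :=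
      isOpen_lt continuous_const (by fun_prop)
    obtain ⟨_, hy, z, hz, rfl⟩ := mem_closure_iff.1 (hξ' n) _ hopen hn
    exact (hsub (K n) hz).2 (show 1 / ((n : ℝ) + 1) ≤ ht z from le_of_lt hy)
  refine ⟨ξ, Set.mem_iInter.2 fun L => ⟨?_, hξb⟩⟩
  obtain ⟨t, ht0, htL⟩ := exists_forall_le_ht L.isCompact
  obtain ⟨n, hn⟩ := exists_nat_one_div_lt ht0
  exact closure_mono (Set.image_mono (e.antitone L (K n) fun x hx => hn.le.trans (htL x hx)))
    (hξ' n)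

lemma SetEnd.norm_eq_one {C : Set (HypSpace d)} (e : SetEnd C) {ξ : EuclideanSpace ℝ (Fin d)}
    (hξ : ξ ∈ e.boundary) : ‖ξ‖ = 1 := by
  obtain ⟨h1, h2⟩ := Set.mem_iInter.1 hξ ⊥
  refine le_antisymm ?_ (by simpa using h2)
  have : ξ ∈ Metric.closedBall (0 : EuclideanSpace ℝ (Fin d)) 1 := by
    refine closure_minimal ?_ Metric.isClosed_closedBall h1
    rintro _ ⟨x, _, rfl⟩
    exact Metric.ball_subset_closedBall x.2
  simpa using this

end HypGraph
end

/-! ### Conclusion -/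

theorem mainTheorem6 (d : ℕ) (hd : 2 ≤ d) (G : HypGraph d)
    (hconn : G.graph.Connected)
    (hfin : G.IsLocallyFinite)
    (htrans : G.IsTransitiveUnderIsometries)
    (o : G.verts) (p : unitInterval) (hp : (p : ℝ) < G.pZero o) :
    ∀ᵐ ω ∂(G.percolation p), ∀ (v : G.verts) (e : SetEnd (G.cluster ω v)),
      ∃ ξ : HypInfinity d, e.boundary = {(ξ : EuclideanSpace ℝ (Fin d))} := by
  obtain ⟨S, hS0, hS⟩ := HypGraph.exists_forall_adj_sep_le hfin htrans o
  -- Countably many `δ` suffice, and crossings mention neither `v` nor `e`, so one null set serves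
  -- all clusters and all ends.
  have hall := MeasureTheory.ae_all_iff.2 fun j : ℕ =>
    HypGraph.ae_not_eventually_crossing hfin htrans o hp (c := 2 + 4 * S)
      (δ := 1 / ((j : ℝ) + 1)) (by positivity) (by positivity)
  filter_upwards [hall] with ω hω v e
  obtain ⟨ξ, hξ⟩ := HypGraph.SetEnd.boundary_nonempty e
  refine ⟨⟨ξ, by simpa using HypGraph.SetEnd.norm_eq_one e hξ⟩, ?_⟩
  refine Set.eq_singleton_iff_unique_mem.2 ⟨hξ, fun η hη => ?_⟩
  by_contra hne
  have hne' : ξ ≠ η := fun h => hne h.symm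
  have hΔ : 0 < ‖ξ - η‖ := norm_pos_iff.2 (sub_ne_zero.2 hne')
  obtain ⟨j, hj⟩ := exists_nat_one_div_lt (show 0 < ‖ξ - η‖ / 4 by positivity)
  -- The first bound puts `v` above the slab; the second makes slab edges short compared with `‖ξ -
  -- η‖`, the `+ 1` avoiding division by zero when `S = 0`.
  refine hω j ⟨min (HypSpace.ht (v : HypSpace d)) (‖ξ - η‖ / 8 / (√S + 1)),
    lt_min (HypSpace.ht_pos _) (by positivity), fun h hh hlt => ?_⟩
  obtain ⟨h1, h2⟩ := lt_min_iff.1 hlt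
  have h3 : √S * h ≤ ‖ξ - η‖ / 8 := by
    rw [lt_div_iff₀ (by positivity)] at h2
    nlinarith [Real.sqrt_nonneg S]
  obtain ⟨x, hx, hcx, y, hy, hc⟩ :=
    HypGraph.mem_crossing_of_end hfin hS0 hS e hξ hη hh h1 h3 hne'
  exact ⟨x, hx, hcx, y, hj.le.trans hy, hc⟩
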